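/- Let $\alpha\in(1,2)$. For $n\ge 1$ let $G_n$ be the random graph of long range edges on the nodes $\{0,\dots,n-1\}$ of the $n$-cycle: each of the $\binom n2$ pairs of distinct nodes (pairs adjacent on the cycle included) is a long range edge independently with probability $2n^{-\alpha}$. "A.a.s." means with probability tending to $1$ as $n\to\infty$. Call a real number $d$ a degree bound for $\alpha$ if a.a.s. no node has more than $d$ long range edges. Fix $q_c,q_l>0$ with $2q_c+q_l\le 1$ and $|r|\le q_c$. Given $d$, the homogeneous chain moves from $i$ to $i+1$ (mod $n$) with probability $q_c+r$, from $i$ to $i-1$ with probability $q_c-r$, along each long range edge at $i$ with probability $q_l/d$ (probabilities of parallel edges add up), and otherwise stays put; it is called reversible homogeneous if $r=0$, and lazy if every state is kept with probability at least $1/2$. For a transition matrix $P$ with a unique stationary distribution $\pi$ and for $\varepsilon>0$, the mixing time is $$t_{\rm mix}(P,\varepsilon)=\max_\sigma\min\{k\in\mathbb N:\|\sigma P^k-\pi\|_{\rm TV}\le\varepsilon\},\qquad \|\mu-\nu\|_{\rm TV}=\max_A|\mu(A)-\nu(A)|,$$ where $\sigma$ runs over all initial distributions. Fix $\varepsilon\in(0,1)$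 and write $t_{\rm mix}=t_{\rm mix}(P,\varepsilon)$. **Theorem.** For every $\alpha\in(1,2)$ there is a degree bound $d(\alpha)$, and the following holds for every choice of the degree bound $d=d(\alpha)$. There are constants $c_1,c_2>0$ (where $c_1$ may depend on $\varepsilon,q_c,q_l,r,\alpha$ but not on $d(\alpha)$, and $c_2$ may depend on $\varepsilon,q_c,q_l,r$ but not on $\alpha$ or $d(\alpha)$; the constants may differ in the two parts) such that: 1. If $r=0$, then a.a.s. the reversible homogeneous chain is a Markov chain with a unique stationary distribution, and $$c_1n^{2\alpha-2}\log^2 n<t_{\rm mix}<c_2\,d(\alpha)^2\,n^{2\alpha-2}\log^3 n.$$ 2. For arbitrary $r$ (in particular for the non-reversible chains, $r\ne0$), a.a.s. the homogeneous chain is a Markov chain, it is lazy if $2q_c+q_l\le\frac12$, and if it is lazy, then it has a unique stationary distribution and $$c_1n^{\alpha-1}\log n<t_{\rm mix}<c_2\,d(\alpha)^2\,n^{2\alpha-2}\log^3 n.$$ -/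

import Mathlib

open Filter Topology
open scoped Matrix

noncomputable section

namespace CycleMixing

/-! ### Mixing times of finite Markov chains -/

/-- Total variation distance `max_A |μ(A) - ν(A)|` of two distributions on a finite set, given by
their probability vectors. -/
def tvDist {X : Type*} [Fintype X] (μ ν : X → ℝ) : ℝ :=
  ⨆ A : Finset X, |∑ i ∈ A, μ i - ∑ i ∈ A, ν i|

/-- `π` is a stationary distribution of the chain with transition matrix `P`. -/
def IsStationary {X : Type*} [Fintype X] (P : Matrix X X ℝ) (π : X → ℝ) : Prop :=
  π ∈ stdSimplex ℝ X ∧ π ᵥ* P = π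

/-- The time `max_σ min {k : ‖σ P ^ k - π‖_TV ≤ ε}`, where `σ` ranges over all initial
distributions; it is `⊤` if for some `σ` there is no such `k` (or no common bound for these
minima). It is the mixing time of `P` when `π` is the unique stationary distribution of `P`. -/
def mixingTime {X : Type*} [Fintype X] [DecidableEq X] (P : Matrix X X ℝ) (π : X → ℝ) (ε : ℝ) :
    ℕ∞ :=
  ⨆ σ ∈ stdSimplex ℝ X, ⨅ (k : ℕ) (_ : tvDist (σ ᵥ* P ^ k) π ≤ ε), (k : ℕ∞)

/-- `P` has a unique stationary distribution, and its mixing time is a (finite) number strictly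
between `lo` and `hi`. -/
def MixingTimeBetween {X : Type*} [Fintype X] [DecidableEq X] (P : Matrix X X ℝ)
    (ε lo hi : ℝ) : Prop :=
  ∃ π : X → ℝ, IsStationary P π ∧ (∀ π', IsStationary P π' → π' = π) ∧
    ∃ t : ℕ, mixingTime P π ε = (t : ℕ∞) ∧ lo < (t : ℝ) ∧ (t : ℝ) < hi

/-- Every state is kept with probability at least `1/2`. -/
def IsLazy {X : Type*} (P : Matrix X X ℝ) : Prop :=
  ∀ i, 1 / 2 ≤ P i i

/-! ### The random graph and the homogeneous chain -/

/-- The law of the long range edges: each of the `n.choose 2` pairs of distinct nodes is an edge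
independently with probability `2 n ^ (-α)`. (The number `2 n ^ (-α)` lies in `[0, 1]` for
`n ≥ 2`, `α > 1`; the projection to `[0, 1]` only matters for `n = 1`, where there are no pairs.) -/
def longRangeLaw (α : ℝ) (n : ℕ) : MeasureTheory.Measure (SimpleGraph (Fin n)) :=
  SimpleGraph.binomialRandom (Fin n)
    (Set.projIcc (0 : ℝ) 1 zero_le_one (2 * (n : ℝ) ^ (-α)))

/-- The property `E` of the graph of long range edges holds asymptotically almost surely as the
number `n` of nodes tends to infinity. -/
def AAS (α : ℝ) (E : ∀ n : ℕ, SimpleGraph (Fin n) → Prop) : Prop :=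
  Tendsto (fun n : ℕ => longRangeLaw α n {G | E n G}) atTop (𝓝 1)

/-- A.a.s. no node has more than `d` long range edges. -/
def IsDegreeBound (α d : ℝ) : Prop :=
  AAS α fun _ G => ∀ v, ((G.neighborSet v).ncard : ℝ) ≤ d

open Classical in
/-- The weights of the moves of the homogeneous chain on the cycle `0, 1, …, n - 1, 0` with long
range edges `G`: `qc + r` for the clockwise step `i ↦ i + 1`, `qc - r` for the counterclockwise
step `i + 1 ↦ i`, and `ql / d` for each long range edge. A long range edge may join neighbours on
the cycle; the two weights then add up. -/
def moveWeight {n : ℕ} (G : SimpleGraph (Fin n)) (qc ql r d : ℝ) : Matrix (Fin n) (Fin n) ℝ :=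
  fun i j => (if j = finRotate n i then qc + r else 0) + (if i = finRotate n j then qc - r else 0)
    + (if G.Adj i j then ql / d else 0)

/-- The transition matrix of the homogeneous chain: the moves above, and with the remaining
probability the chain stays put. -/
def homogeneousChain {n : ℕ} (G : SimpleGraph (Fin n)) (qc ql r d : ℝ) :
    Matrix (Fin n) (Fin n) ℝ :=
  moveWeight G qc ql r d + Matrix.diagonal fun i => 1 - ∑ j, moveWeight G qc ql r d i j

end CycleMixing

end

/-! Everything is measured against `Λ = n ^ (α - 1) * log n`. Up to constants this is the length of
the longest arcs free of long range edges, and at this scale the long range edges begin to control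
the boundary of every set.

Upper bound. The chain is doubly stochastic, so the uniform distribution is stationary. Its
Dirichlet form does not see the drift, so `cheeger` turns conductance `φ` into a gap `φ² / 2`. The
conductance comes from `aas_isoperimetry`, a union bound over all sets `S` of at most half of the
nodes. A set is determined by its cycle boundary and one bit, so at most two sets share a given
boundary. If `S` has `b` boundary edges on the cycle and more than `8 Λ b` nodes, the mean number of
long range edges leaving it exceeds `8 b log n`. A Chernoff bound then makes a shortage of such
edges rarer than `n ^ (-2 b)`. Hence `φ` can be taken as a constant over `d Λ`, and `O(log n / φ²)`
steps suffice.

A gap at the top of the spectrum gives contraction of mean-zero vectors only if the bottom is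
controlled too. For lazy chains, `sum_sq_vecMul_le_of_isLazy` does this without symmetry. For the
reversible chain, which need not be lazy, `exists_aas_window` places a node without long range edges
in every window of bounded length. Such a node holds with probability at least `ql`, and
`neg_le_sum_vecMul_mul` propagates this along the cycle to keep the spectrum away from `-1`.

Lower bound. A second moment argument, `exists_aas_free_arc`, finds an arc of length of order `Λ`
that meets no long range edge. Started at its middle, the chain is a nearest neighbour walk until it
leaves the arc. It therefore needs about `Λ²` steps without drift (`exists_start_diffusive`) and at
least about `Λ` steps in general (`exists_start_ballistic`). Until then it sits with substantial
probability in a set of proportion `o(1)`, far from uniform. -/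

noncomputable section

namespace CycleMixing

open MeasureTheory

/-! ### Edge counts of the binomial random graph -/

section EdgeCount

variable {V : Type*} [Fintype V] [DecidableEq V]

instance : MeasurableSingletonClass (SimpleGraph V) where
  measurableSet_singleton G := by
    have : ({G} : Set (SimpleGraph V)) = SimpleGraph.edgeSet ⁻¹' {G.edgeSet} := by
      ext H; simp
    rw [this]
    exact SimpleGraph.measurableEmbedding_edgeSet.measurable (MeasurableSet.singleton _)

open Classical in
/-- The number of edges of `G` that belong to `T`. -/
def edgesIn (G : SimpleGraph V) (T : Finset (Sym2 V)) : ℕ :=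
  (T.filter (· ∈ G.edgeSet)).card

/-- By independence the generating function of the edge count factors over the pairs in `T`. Every
tail bound below is this identity at a suitable `a`; the value `a = 0` gives the probability of no
edge. -/
lemma integral_pow_edgesIn (p : unitInterval) (T : Finset (Sym2 V)) (hT : ∀ e ∈ T, ¬ e.IsDiag)
    (a : ℝ) :
    ∫ G, a ^ edgesIn G T ∂(SimpleGraph.binomialRandom V p) =
      (1 - (p : ℝ) + p * a) ^ T.card := by
  classical
  set U : Finset (Sym2 V) := Finset.univ.filter (fun e => ¬ e.IsDiag) with hU
  have hTU : T ⊆ U := fun e he => by simp [hU, hT e he]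
  have hreal : ∀ G : SimpleGraph V, (SimpleGraph.binomialRandom V p).real {G} =
      (p : ℝ) ^ G.edgeFinset.card * (1 - (p : ℝ)) ^ (U \ G.edgeFinset).card := by
    intro G
    have hsub : G.edgeFinset ⊆ U := by
      intro e he
      simp only [hU, Finset.mem_filter, Finset.mem_univ, true_and]
      exact G.not_isDiag_of_mem_edgeSet (by simpa using he)
    have hUc : U.card = (Fintype.card V).choose 2 := by
      rw [← Sym2.card_diagSet_compl, hU, ← Fintype.card_coe]
      refine Fintype.card_congr (Equiv.subtypeEquivRight ?_)
      intro e
      simp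
    have hnc : G.edgeSet.ncard = G.edgeFinset.card := by
      rw [← SimpleGraph.coe_edgeFinset, Set.ncard_coe_finset]
    rw [measureReal_def, SimpleGraph.binomialRandom_singleton, Finset.card_sdiff_of_subset hsub,
      hUc, hnc, Nat.card_eq_fintype_card]
    simp
  rw [integral_fintype (.of_finite)]
  have key : ∀ s : Finset (Sym2 V), s ⊆ U →
      a ^ (T ∩ s).card = ∏ e ∈ s, (if e ∈ T then a else 1) := by
    intro s _
    rw [Finset.prod_ite, Finset.prod_const_one, mul_one, Finset.prod_const]
    congr 2
    ext e; simp [and_comm]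
  have h1 : ∑ G : SimpleGraph V, (SimpleGraph.binomialRandom V p).real {G} • a ^ edgesIn G T =
      ∑ s ∈ U.powerset, (∏ e ∈ s, (p : ℝ) * (if e ∈ T then a else 1)) *
        ∏ e ∈ U \ s, (1 - (p : ℝ)) := by
    refine Finset.sum_bij' (fun G _ => G.edgeFinset)
      (fun s _ => SimpleGraph.fromEdgeSet (s : Set (Sym2 V))) ?_ ?_ ?_ ?_ ?_
    · intro G _
      simp only [Finset.mem_powerset]
      intro e he
      simp only [hU, Finset.mem_filter, Finset.mem_univ, true_and]
      exact G.not_isDiag_of_mem_edgeSet (by simpa using he)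
    · intro s _; simp
    · intro G _; simp
    · intro s hs
      have hs' : s ⊆ U := by simpa using hs
      ext e
      simp only [SimpleGraph.mem_edgeFinset, SimpleGraph.edgeSet_fromEdgeSet]
      constructor
      · intro h; exact_mod_cast h.1
      · intro h
        refine ⟨by exact_mod_cast h, ?_⟩
        have := hs' h
        simpa [hU] using this
    · intro G _
      have hsub : G.edgeFinset ⊆ U := by
        intro e he
        simp only [hU, Finset.mem_filter, Finset.mem_univ, true_and]
        exact G.not_isDiag_of_mem_edgeSet (by simpa using he)
      rw [hreal, Finset.prod_mul_distrib, ← key _ hsub]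
      have : edgesIn G T = (T ∩ G.edgeFinset).card := by
        unfold edgesIn
        congr 1
        ext e; simp
      rw [this]
      simp only [Finset.prod_const, smul_eq_mul]
      ring
  -- The sum over all edge sets is an expanded product, one factor per possible pair. Pairs outside
  -- `T` contribute the factor `1`.
  rw [h1, ← Finset.prod_add]
  have h2 : ∀ e ∈ U, ((p : ℝ) * (if e ∈ T then a else 1) + (1 - (p : ℝ))) =
      if e ∈ T then (1 - (p : ℝ) + p * a) else 1 := by
    intro e _
    split_ifs <;> ring
  rw [Finset.prod_congr rfl h2, Finset.prod_ite, Finset.prod_const_one, mul_one,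
    Finset.prod_const]
  congr 2
  ext e
  simp only [Finset.mem_filter]
  exact ⟨fun h => h.2, fun h => ⟨hTU h, h⟩⟩

omit [DecidableEq V] in
lemma integrable_graph {p : unitInterval} (f : SimpleGraph V → ℝ) :
    Integrable f (SimpleGraph.binomialRandom V p) := .of_finite

omit [DecidableEq V] in
lemma measurableSet_graph (E : Set (SimpleGraph V)) : MeasurableSet E :=
  (Set.toFinite E).measurableSet

lemma measureReal_edgesIn_eq_zero (p : unitInterval) (T : Finset (Sym2 V))
    (hT : ∀ e ∈ T, ¬ e.IsDiag) :
    (SimpleGraph.binomialRandom V p).real {G | edgesIn G T = 0} = (1 - (p : ℝ)) ^ T.card := by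
  have h := integral_pow_edgesIn p T hT 0
  rw [mul_zero, add_zero] at h
  rw [← h, ← integral_indicator_one (measurableSet_graph _)]
  congr 1
  ext G
  by_cases hG : edgesIn G T = 0
  · simp [hG]
  · simp [hG]

omit [DecidableEq V] in
lemma measureReal_le_integral {p : unitInterval} (E : Set (SimpleGraph V))
    (f : SimpleGraph V → ℝ) (h0 : ∀ G, 0 ≤ f G) (h1 : ∀ G ∈ E, 1 ≤ f G) :
    (SimpleGraph.binomialRandom V p).real E ≤ ∫ G, f G ∂(SimpleGraph.binomialRandom V p) := by
  rw [← integral_indicator_one (measurableSet_graph _)]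
  refine integral_mono (integrable_graph _) (integrable_graph _) ?_
  intro G
  by_cases hG : G ∈ E
  · simpa [hG] using h1 G hG
  · simpa [hG] using h0 G

/-- Chernoff's method at `a = exp (-1)`: since `exp (-1) ≤ 1 / 2`, the generating function is at
most `exp (-m / 2)` for the mean `m`, and Markov's inequality costs back `exp (m / 4)`. -/
lemma measureReal_edgesIn_lt (p : unitInterval) (T : Finset (Sym2 V))
    (hT : ∀ e ∈ T, ¬ e.IsDiag) :
    (SimpleGraph.binomialRandom V p).real {G | (edgesIn G T : ℝ) < p * T.card / 4} ≤
      Real.exp (-(p * T.card / 4)) := by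
  set m : ℝ := p * T.card with hm
  have hm0 : 0 ≤ m := mul_nonneg p.2.1 (Nat.cast_nonneg _)
  have hb := measureReal_le_integral (p := p) {G | (edgesIn G T : ℝ) < m / 4}
    (fun G => Real.exp (m / 4) * (Real.exp (-1)) ^ edgesIn G T)
    (fun G => by positivity) (fun G hG => by
      rw [← Real.exp_nat_mul, ← Real.exp_add]
      apply Real.one_le_exp
      have : (edgesIn G T : ℝ) < m / 4 := hG
      linarith)
  refine hb.trans ?_
  rw [integral_const_mul, integral_pow_edgesIn p T hT]
  have he : Real.exp (-1) ≤ 1 / 2 := by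
    rw [Real.exp_neg, ← one_div]
    apply one_div_le_one_div_of_le (by norm_num)
    have := Real.add_one_le_exp 1
    linarith
  have hbase : (1 - (p : ℝ) + p * Real.exp (-1)) ≤ Real.exp (-(p / 2)) := by
    have h1 := Real.add_one_le_exp (-((p : ℝ) / 2))
    have h2 : (p : ℝ) * Real.exp (-1) ≤ p * (1 / 2) := mul_le_mul_of_nonneg_left he p.2.1
    linarith
  have hbase0 : 0 ≤ (1 - (p : ℝ) + p * Real.exp (-1)) := by
    have h1 : 0 ≤ (p : ℝ) * Real.exp (-1) := mul_nonneg p.2.1 (Real.exp_nonneg _)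
    have h2 := p.2.2
    linarith
  calc Real.exp (m / 4) * (1 - (p : ℝ) + p * Real.exp (-1)) ^ T.card
      ≤ Real.exp (m / 4) * (Real.exp (-(p / 2))) ^ T.card := by gcongr
    _ = Real.exp (-(m / 4)) := by
      rw [← Real.exp_nat_mul, ← Real.exp_add]
      congr 1
      rw [hm]; ring

/-- For `B ≤ 1`, the generating function at `a = 1 / B` stays below `exp 1`, and Markov's inequality
gains `B ^ m`. For `B ≥ 1` the bound exceeds `1`. It is used with `B` tending to zero and `m` fixed.
-/
lemma measureReal_le_edgesIn (p : unitInterval) (T : Finset (Sym2 V))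
    (hT : ∀ e ∈ T, ¬ e.IsDiag) {B : ℝ} (hB : 0 < B) (hTB : (p : ℝ) * T.card ≤ B) (m : ℕ) :
    (SimpleGraph.binomialRandom V p).real {G | m ≤ edgesIn G T} ≤ Real.exp 1 * B ^ m := by
  rcases le_total 1 B with hB1 | hB1
  · refine (measureReal_le_one).trans ?_
    have := one_le_pow₀ hB1 (n := m)
    have h2 := Real.one_le_exp (zero_le_one)
    nlinarith
  have hb := measureReal_le_integral (p := p) {G | m ≤ edgesIn G T}
    (fun G => B ^ m * (1 / B) ^ edgesIn G T)
    (fun G => by positivity) (fun G hG => by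
      have hG' : m ≤ edgesIn G T := hG
      have : (1 / B) ^ m ≤ (1 / B) ^ edgesIn G T :=
        pow_le_pow_right₀ (by rw [le_div_iff₀ hB]; linarith) hG'
      calc (1 : ℝ) = B ^ m * (1 / B) ^ m := by rw [← mul_pow]; field_simp; simp
        _ ≤ _ := by gcongr)
  refine hb.trans ?_
  rw [integral_const_mul, integral_pow_edgesIn p T hT, mul_comm]
  gcongr
  have hbase : (1 - (p : ℝ) + p * (1 / B)) ≤ Real.exp (p / B) := by
    have h1 := Real.add_one_le_exp ((p : ℝ) / B)
    have h2 := p.2.1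
    have : (p : ℝ) * (1 / B) = p / B := by ring
    linarith
  have hbase0 : 0 ≤ (1 - (p : ℝ) + p * (1 / B)) := by
    have h1 : 0 ≤ (p : ℝ) * (1 / B) := mul_nonneg p.2.1 (by positivity)
    have h2 := p.2.2
    linarith
  calc (1 - (p : ℝ) + p * (1 / B)) ^ T.card ≤ (Real.exp (p / B)) ^ T.card := by gcongr
    _ = Real.exp (p * T.card / B) := by rw [← Real.exp_nat_mul]; congr 1; ring
    _ ≤ Real.exp 1 := by
      apply Real.exp_le_exp.2
      rw [div_le_one hB]; exact hTB

end EdgeCount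

/-! ### Events that hold asymptotically almost surely -/

instance (α : ℝ) (n : ℕ) : IsProbabilityMeasure (longRangeLaw α n) := by
  unfold longRangeLaw; infer_instance

lemma aas_iff_real {α : ℝ} {E : ∀ n : ℕ, SimpleGraph (Fin n) → Prop} :
    AAS α E ↔ Tendsto (fun n => (longRangeLaw α n).real {G | ¬ E n G}) atTop (𝓝 0) := by
  have h1 : ∀ n, (longRangeLaw α n).real {G | ¬ E n G} =
      1 - (longRangeLaw α n).real {G | E n G} := fun n => by
    rw [← probReal_compl_eq_one_sub (measurableSet_graph _)]; rfl
  have h2 : AAS α E ↔ Tendsto (fun n => (longRangeLaw α n).real {G | E n G}) atTop (𝓝 1) := by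
    unfold AAS
    rw [← ENNReal.tendsto_toReal_iff (fun n => measure_ne_top _ _) ENNReal.one_ne_top]
    rfl
  rw [h2]
  simp_rw [h1]
  constructor
  · intro h
    simpa using h.const_sub 1
  · intro h
    simpa using h.const_sub 1

lemma AAS.of_le {α : ℝ} {E : ∀ n : ℕ, SimpleGraph (Fin n) → Prop} {b : ℕ → ℝ}
    (hb : Tendsto b atTop (𝓝 0))
    (h : ∀ᶠ n in atTop, (longRangeLaw α n).real {G | ¬ E n G} ≤ b n) : AAS α E :=
  aas_iff_real.2 <| tendsto_of_tendsto_of_tendsto_of_le_of_le' tendsto_const_nhds hb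
    (Eventually.of_forall fun _ => measureReal_nonneg) h

lemma AAS.and {α : ℝ} {E F : ∀ n : ℕ, SimpleGraph (Fin n) → Prop} (hE : AAS α E)
    (hF : AAS α F) : AAS α fun n G => E n G ∧ F n G := by
  have h := (aas_iff_real.1 hE).add (aas_iff_real.1 hF)
  rw [add_zero] at h
  refine AAS.of_le h (Eventually.of_forall fun n => ?_)
  refine (measureReal_mono ?_).trans (measureReal_union_le _ _)
  intro G hG
  simp only [Set.mem_union, Set.mem_ofPred_eq] at hG ⊢
  tauto

lemma AAS.mono {α : ℝ} {E F : ∀ n : ℕ, SimpleGraph (Fin n) → Prop} (hE : AAS α E)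
    (h : ∀ᶠ n in atTop, ∀ G, E n G → F n G) : AAS α F := by
  refine AAS.of_le (aas_iff_real.1 hE) ?_
  filter_upwards [h] with n hn
  exact measureReal_mono fun G hG hE => hG (hn G hE)

lemma AAS.exists {α : ℝ} {E : ∀ n : ℕ, SimpleGraph (Fin n) → Prop} (hE : AAS α E) :
    ∃ n, ∃ G : SimpleGraph (Fin n), E n G := by
  by_contra! h
  have h1 := aas_iff_real.1 hE
  have h2 : ∀ n, (longRangeLaw α n).real {G | ¬ E n G} = 1 := fun n => by
    have : {G | ¬ E n G} = Set.univ := by ext G; simp [h n G]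
    rw [this]; simp
  simp_rw [h2] at h1
  exact zero_ne_one (tendsto_nhds_unique h1 tendsto_const_nhds)

/-! ### Cheeger's inequality -/

section Cheeger

variable {X : Type*} [Fintype X] [DecidableEq X]

/-- The coarea inequality: an isoperimetric inequality for small sets yields an `ℓ¹` inequality
for nonnegative functions with small support. -/
lemma le_sum_mul_abs_sub {w : X → X → ℝ} (hsymm : ∀ i j, w i j = w j i)
    {φ : ℝ}
    (hcut : ∀ S : Finset X, 2 * S.card ≤ Fintype.card X →
      φ * S.card ≤ ∑ i ∈ S, ∑ j ∈ Sᶜ, w i j)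
    (u : X → ℝ) (hu : ∀ i, 0 ≤ u i)
    (hsupp : 2 * (Finset.univ.filter (fun i => 0 < u i)).card ≤ Fintype.card X) :
    2 * φ * ∑ i, u i ≤ ∑ i, ∑ j, w i j * |u i - u j| := by
  induction hk : (Finset.univ.filter (fun i => 0 < u i)).card using Nat.strong_induction_on
    generalizing u with
  | _ k ih =>
    set S := Finset.univ.filter (fun i => 0 < u i) with hS
    rcases S.eq_empty_or_nonempty with h0 | hne
    · have hu0 : ∀ i, u i = 0 := by
        intro i
        by_contra hi
        have : i ∈ S := by
          simp only [hS, Finset.mem_filter, Finset.mem_univ, true_and]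
          exact lt_of_le_of_ne (hu i) (Ne.symm hi)
        rw [h0] at this; simp at this
      simp [hu0]
    · obtain ⟨m, hmS, hmin⟩ := S.exists_min_image u hne
      have hm0 : 0 < u m := by simpa [hS] using hmS
      -- Remove the lowest layer: its height is the least positive value of `u` and its base is the
      -- support. The variation splits additively, the layer's share being a cut of `S`, and the
      -- support shrinks strictly.
      set u' : X → ℝ := fun i => u i - u m * (if i ∈ S then 1 else 0) with hu'
      have hout : ∀ i, i ∉ S → u i = 0 := by
        intro i hi
        have : ¬ 0 < u i := by simpa [hS] using hi
        exact le_antisymm (not_lt.1 this) (hu i)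
      have hu'0 : ∀ i, 0 ≤ u' i := by
        intro i
        by_cases hi : i ∈ S
        · simpa [hu', hi] using hmin i hi
        · simp [hu', hi, hu i]
      have hsub : (Finset.univ.filter (fun i => 0 < u' i)) ⊂ S := by
        refine Finset.ssubset_iff_of_subset ?_ |>.2 ⟨m, hmS, by simp [hu', hmS]⟩
        intro i hi
        by_contra hiS
        have : 0 < u' i := by simpa using hi
        simp [hu', hiS, hout i hiS] at this
      have hlt := Finset.card_lt_card hsub
      have hih := ih _ (hk ▸ hlt) u' hu'0 (by omega) rfl
      have habs : ∀ i j, |u i - u j| = |u' i - u' j| +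
          u m * |(if i ∈ S then (1 : ℝ) else 0) - (if j ∈ S then 1 else 0)| := by
        intro i j
        by_cases hi : i ∈ S <;> by_cases hj : j ∈ S
        · simp [hu', hi, hj]
        · have := hmin i hi
          simp only [hu', hi, hj, hout j hj, if_true, if_false, mul_one, mul_zero, sub_zero]
          rw [abs_of_nonneg (hu i), abs_of_nonneg (by linarith), abs_one]; ring
        · have := hmin j hj
          simp only [hu', hi, hj, hout i hi, if_true, if_false, mul_one, mul_zero, sub_zero,
            zero_sub, abs_neg]
          rw [abs_of_nonneg (hu j), abs_of_nonneg (by linarith), abs_one]; ring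
        · simp [hu', hi, hj]
      have hind : ∑ i, ∑ j, w i j *
          |(if i ∈ S then (1 : ℝ) else 0) - (if j ∈ S then 1 else 0)| =
          2 * ∑ i ∈ S, ∑ j ∈ Sᶜ, w i j := by
        have e1 : ∀ i j, w i j * |(if i ∈ S then (1 : ℝ) else 0) - (if j ∈ S then 1 else 0)| =
            (if i ∈ S then (if j ∈ Sᶜ then w i j else 0) else 0) +
            (if j ∈ S then (if i ∈ Sᶜ then w j i else 0) else 0) := by
          intro i j
          by_cases hi : i ∈ S <;> by_cases hj : j ∈ S <;> simp [hi, hj, hsymm i j]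
        simp_rw [e1, Finset.sum_add_distrib]
        have e2 : ∑ i, ∑ j, (if i ∈ S then (if j ∈ Sᶜ then w i j else 0) else 0) =
            ∑ i ∈ S, ∑ j ∈ Sᶜ, w i j := by
          rw [← Finset.sum_filter_add_sum_filter_not Finset.univ (· ∈ S)]
          rw [Finset.sum_eq_zero (s := Finset.univ.filter (fun i => ¬ i ∈ S))]
          · rw [add_zero, Finset.filter_mem_eq_inter, Finset.univ_inter]
            refine Finset.sum_congr rfl fun i hi => ?_
            simp only [hi, if_true]
            rw [← Finset.sum_filter, Finset.filter_mem_eq_inter, Finset.univ_inter]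
          · intro i hi
            have : i ∉ S := by simpa using hi
            simp [this]
        have e3 : ∑ i, ∑ j, (if j ∈ S then (if i ∈ Sᶜ then w j i else 0) else 0) =
            ∑ i ∈ S, ∑ j ∈ Sᶜ, w i j := by
          rw [Finset.sum_comm, e2]
        rw [e2, e3]; ring
      have hsum : ∑ i, u i = ∑ i, u' i + u m * S.card := by
        simp only [hu', Finset.sum_sub_distrib, ← Finset.mul_sum]
        simp
      have hSc := hcut S hsupp
      calc 2 * φ * ∑ i, u i = 2 * φ * ∑ i, u' i + u m * (2 * (φ * S.card)) := by
            rw [hsum]; ring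
        _ ≤ ∑ i, ∑ j, w i j * |u' i - u' j| +
            u m * (2 * ∑ i ∈ S, ∑ j ∈ Sᶜ, w i j) := by gcongr
        _ = _ := by
          rw [← hind]
          simp_rw [habs, mul_add, Finset.sum_add_distrib]
          congr 1
          rw [Finset.mul_sum]
          refine Finset.sum_congr rfl fun i _ => ?_
          rw [Finset.mul_sum]
          exact Finset.sum_congr rfl fun j _ => by ring

/-- Apply the coarea inequality to `g ^ 2`, write `|g i ^ 2 - g j ^ 2|` as `|g i - g j| * |g i + g
j|` and use Cauchy–Schwarz. The factor with sums is at most `4 * ∑ i, g i ^ 2` because row sums are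
at most `1`. -/
lemma cheeger_of_support {w : X → X → ℝ} (hw : ∀ i j, 0 ≤ w i j)
    (hsymm : ∀ i j, w i j = w j i) (hrow : ∀ i, ∑ j, w i j ≤ 1) {φ : ℝ} (hφ : 0 ≤ φ)
    (hcut : ∀ S : Finset X, 2 * S.card ≤ Fintype.card X →
      φ * S.card ≤ ∑ i ∈ S, ∑ j ∈ Sᶜ, w i j)
    (g : X → ℝ) (hg : ∀ i, 0 ≤ g i)
    (hsupp : 2 * (Finset.univ.filter (fun i => 0 < g i)).card ≤ Fintype.card X) :
    φ ^ 2 * ∑ i, g i ^ 2 ≤ ∑ i, ∑ j, w i j * (g i - g j) ^ 2 := by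
  set N := ∑ i, g i ^ 2 with hN
  set E := ∑ i, ∑ j, w i j * (g i - g j) ^ 2 with hE
  have hN0 : 0 ≤ N := Finset.sum_nonneg fun i _ => sq_nonneg _
  have hE0 : 0 ≤ E := Finset.sum_nonneg fun i _ => Finset.sum_nonneg fun j _ =>
    mul_nonneg (hw i j) (sq_nonneg _)
  have hco := le_sum_mul_abs_sub hsymm hcut (fun i => g i ^ 2) (fun i => sq_nonneg _) (by
    refine le_trans ?_ hsupp
    refine Nat.mul_le_mul_left 2 (Finset.card_le_card ?_)
    intro i hi
    simp only [Finset.mem_filter, Finset.mem_univ, true_and] at hi ⊢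
    rcases (hg i).lt_or_eq with h | h
    · exact h
    · rw [← h] at hi; simp at hi)
  set B := ∑ i, ∑ j, w i j * |g i ^ 2 - g j ^ 2| with hB
  set F := ∑ i, ∑ j, w i j * (g i + g j) ^ 2 with hF
  have hF4 : F ≤ 4 * N := by
    have h1 : F ≤ ∑ i, ∑ j, (2 * (w i j * g i ^ 2) + 2 * (w j i * g j ^ 2)) := by
      refine Finset.sum_le_sum fun i _ => Finset.sum_le_sum fun j _ => ?_
      rw [← hsymm i j]
      nlinarith [mul_nonneg (hw i j) (sq_nonneg (g i - g j))]
    have h2 : ∑ i, ∑ j, w i j * g i ^ 2 ≤ N := by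
      refine Finset.sum_le_sum fun i _ => ?_
      rw [← Finset.sum_mul]
      nlinarith [hrow i, sq_nonneg (g i)]
    have h3 : ∑ i, ∑ j, (2 * (w i j * g i ^ 2) + 2 * (w j i * g j ^ 2)) =
        4 * ∑ i, ∑ j, w i j * g i ^ 2 := by
      simp_rw [Finset.sum_add_distrib, ← Finset.mul_sum]
      rw [Finset.sum_comm (f := fun i j => w j i * g j ^ 2)]
      ring
    linarith
  have hCS : B ^ 2 ≤ E * F := by
    simp only [hB, hE, hF, ← Finset.sum_product']
    refine Finset.sum_sq_le_sum_mul_sum_of_sq_le_mul _ (fun x _ => ?_) (fun x _ => ?_)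
      (fun x _ => ?_)
    · exact mul_nonneg (hw _ _) (sq_nonneg _)
    · exact mul_nonneg (hw _ _) (sq_nonneg _)
    · rw [mul_pow, sq_abs]; exact le_of_eq (by ring)
  rcases hN0.eq_or_lt with h0 | hpos
  · rw [← h0, mul_zero]; exact hE0
  · have h1 : (2 * φ * N) ^ 2 ≤ B ^ 2 :=
      pow_le_pow_left₀ (by positivity) hco 2
    have h2 : E * F ≤ E * (4 * N) := mul_le_mul_of_nonneg_left hF4 hE0
    have h3 : (φ ^ 2 * N) * (4 * N) ≤ E * (4 * N) := by nlinarith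
    exact le_of_mul_le_mul_right h3 (by positivity)

/-- Take the smallest value with at most half of the points strictly above it. The next smaller
value has more than half above it, so fewer than half lie strictly below the chosen one. -/
lemma exists_median [Nonempty X] (x : X → ℝ) :
    ∃ m : ℝ, 2 * (Finset.univ.filter (fun i => m < x i)).card ≤ Fintype.card X ∧
      2 * (Finset.univ.filter (fun i => x i < m)).card ≤ Fintype.card X := by
  set A : Finset X := Finset.univ.filter
    (fun i => 2 * (Finset.univ.filter (fun j => x i < x j)).card ≤ Fintype.card X) with hA
  have hAne : A.Nonempty := by
    obtain ⟨i, -, hi⟩ := Finset.univ.exists_max_image x Finset.univ_nonempty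
    refine ⟨i, ?_⟩
    have : (Finset.univ.filter (fun j => x i < x j)) = ∅ := by
      ext j; simpa using hi j (Finset.mem_univ j)
    simp [hA, this]
  obtain ⟨i, hiA, hmin⟩ := A.exists_min_image x hAne
  refine ⟨x i, by simpa [hA] using hiA, ?_⟩
  rcases (Finset.univ.filter (fun j => x j < x i)).eq_empty_or_nonempty with h0 | hne
  · simp [h0]
  · obtain ⟨k, hk, hmax⟩ := (Finset.univ.filter (fun j => x j < x i)).exists_max_image x hne
    have hki : x k < x i := by simpa using hk
    have hkA : k ∉ A := fun h => absurd (hmin k h) (not_le.2 hki)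
    have hkc : Fintype.card X < 2 * (Finset.univ.filter (fun j => x k < x j)).card := by
      simpa [hA] using hkA
    have hcompl : (Finset.univ.filter (fun j => x k < x j)) =
        (Finset.univ.filter (fun j => x j < x i))ᶜ := by
      ext j
      simp only [Finset.mem_filter, Finset.mem_univ, true_and, Finset.mem_compl, not_lt]
      refine ⟨fun h => ?_, fun h => lt_of_lt_of_le hki h⟩
      by_contra hj
      exact absurd (hmax j (by simpa using hj)) (not_le.2 h)
    rw [hcompl, Finset.card_compl] at hkc
    omega

/-- Cheeger's inequality: conductance at least `φ` gives a spectral gap of at least `φ² / 2`. -/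
lemma cheeger {w : X → X → ℝ} (hw : ∀ i j, 0 ≤ w i j)
    (hsymm : ∀ i j, w i j = w j i) (hrow : ∀ i, ∑ j, w i j ≤ 1) {φ : ℝ} (hφ : 0 ≤ φ)
    (hcut : ∀ S : Finset X, 2 * S.card ≤ Fintype.card X →
      φ * S.card ≤ ∑ i ∈ S, ∑ j ∈ Sᶜ, w i j)
    (x : X → ℝ) (hx : ∑ i, x i = 0) :
    φ ^ 2 * ∑ i, x i ^ 2 ≤ ∑ i, ∑ j, w i j * (x i - x j) ^ 2 := by
  rcases isEmpty_or_nonempty X with h | h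
  · simp
  obtain ⟨m, hm1, hm2⟩ := exists_median x
  have hp := cheeger_of_support hw hsymm hrow hφ hcut (fun i => max (x i - m) 0)
    (fun i => le_max_right _ _) (by simpa using hm1)
  have hn := cheeger_of_support hw hsymm hrow hφ hcut (fun i => max (m - x i) 0)
    (fun i => le_max_right _ _) (by simpa using hm2)
  -- The two parts at the median `m` together have squared norm `∑ i, (x i - m) ^ 2`. As `x` has
  -- mean zero, it is smallest at `m = 0`.
  have hsq : ∑ i, x i ^ 2 ≤ ∑ i, (max (x i - m) 0) ^ 2 + ∑ i, (max (m - x i) 0) ^ 2 := by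
    have e : ∀ i, (max (x i - m) 0) ^ 2 + (max (m - x i) 0) ^ 2 = (x i) ^ 2 - 2 * m * x i + m ^ 2 := by
      intro i
      rcases le_total (x i) m with h | h
      · rw [max_eq_right (by linarith), max_eq_left (by linarith)]; ring
      · rw [max_eq_left (by linarith), max_eq_right (by linarith)]; ring
    rw [← Finset.sum_add_distrib]
    simp_rw [e, Finset.sum_add_distrib, Finset.sum_sub_distrib, ← Finset.mul_sum, hx]
    have : 0 ≤ ∑ _i : X, m ^ 2 := Finset.sum_nonneg fun _ _ => sq_nonneg _
    linarith
  -- Energies of the two parts add up to at most that of `x`: for values on opposite sides of `m`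
  -- the missing cross term is nonnegative.
  have hen : ∑ i, ∑ j, w i j * (max (x i - m) 0 - max (x j - m) 0) ^ 2 +
      ∑ i, ∑ j, w i j * (max (m - x i) 0 - max (m - x j) 0) ^ 2 ≤
      ∑ i, ∑ j, w i j * (x i - x j) ^ 2 := by
    rw [← Finset.sum_add_distrib]
    refine Finset.sum_le_sum fun i _ => ?_
    rw [← Finset.sum_add_distrib]
    refine Finset.sum_le_sum fun j _ => ?_
    rw [← mul_add]
    refine mul_le_mul_of_nonneg_left ?_ (hw i j)
    rcases le_total (x i) m with h | h <;> rcases le_total (x j) m with h' | h'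
    · rw [max_eq_right (by linarith), max_eq_right (by linarith), max_eq_left (by linarith),
        max_eq_left (by linarith)]
      exact le_of_eq (by ring)
    · rw [max_eq_right (by linarith), max_eq_left (by linarith), max_eq_left (by linarith),
        max_eq_right (by linarith)]
      nlinarith [mul_nonneg (sub_nonneg.2 h) (sub_nonneg.2 h')]
    · rw [max_eq_left (by linarith), max_eq_right (by linarith), max_eq_right (by linarith),
        max_eq_left (by linarith)]
      nlinarith [mul_nonneg (sub_nonneg.2 h) (sub_nonneg.2 h')]
    · rw [max_eq_left (by linarith), max_eq_left (by linarith), max_eq_right (by linarith),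
        max_eq_right (by linarith)]
      exact le_of_eq (by ring)
  calc φ ^ 2 * ∑ i, x i ^ 2
      ≤ φ ^ 2 * (∑ i, (max (x i - m) 0) ^ 2 + ∑ i, (max (m - x i) 0) ^ 2) := by gcongr
    _ ≤ _ := by rw [mul_add]; linarith

end Cheeger

/-! ### Mixing of doubly stochastic chains -/

section Mixing

variable {X : Type*} [Fintype X] [DecidableEq X]

/-- The Dirichlet form of a doubly stochastic chain as a quadratic form. -/
lemma dirichlet_eq {P : Matrix X X ℝ} (hP : P ∈ doublyStochastic ℝ X) (x : X → ℝ) :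
    ∑ i, ∑ j, P i j * (x i - x j) ^ 2 = 2 * (∑ i, x i ^ 2 - ∑ j, (x ᵥ* P) j * x j) := by
  obtain ⟨-, hr, hc⟩ := mem_doublyStochastic_iff_sum.1 hP
  have h1 : ∑ i, ∑ j, P i j * x i ^ 2 = ∑ i, x i ^ 2 :=
    Finset.sum_congr rfl fun i _ => by rw [← Finset.sum_mul, hr, one_mul]
  have h2 : ∑ i, ∑ j, P i j * x j ^ 2 = ∑ i, x i ^ 2 := by
    rw [Finset.sum_comm]
    exact Finset.sum_congr rfl fun i _ => by rw [← Finset.sum_mul, hc, one_mul]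
  have h3 : ∑ i, ∑ j, x i * P i j * x j = ∑ j, (x ᵥ* P) j * x j := by
    rw [Finset.sum_comm]
    refine Finset.sum_congr rfl fun j _ => ?_
    simp only [Matrix.vecMul, dotProduct, Finset.sum_mul]
  have e : ∀ i j, P i j * (x i - x j) ^ 2 =
      P i j * x i ^ 2 + P i j * x j ^ 2 - 2 * (x i * P i j * x j) := fun i j => by ring
  simp_rw [e, Finset.sum_sub_distrib, Finset.sum_add_distrib, ← Finset.mul_sum, h1, h2, h3]
  ring

/-- A lower bound on this form with plus signs keeps the spectrum away from `-1`, as the Dirichlet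
form does at `1`. -/
lemma dirichlet_add_eq {P : Matrix X X ℝ} (hP : P ∈ doublyStochastic ℝ X) (x : X → ℝ) :
    ∑ i, ∑ j, P i j * (x i + x j) ^ 2 = 2 * (∑ i, x i ^ 2 + ∑ j, (x ᵥ* P) j * x j) := by
  obtain ⟨-, hr, hc⟩ := mem_doublyStochastic_iff_sum.1 hP
  have h1 : ∑ i, ∑ j, P i j * x i ^ 2 = ∑ i, x i ^ 2 :=
    Finset.sum_congr rfl fun i _ => by rw [← Finset.sum_mul, hr, one_mul]
  have h2 : ∑ i, ∑ j, P i j * x j ^ 2 = ∑ i, x i ^ 2 := by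
    rw [Finset.sum_comm]
    exact Finset.sum_congr rfl fun i _ => by rw [← Finset.sum_mul, hc, one_mul]
  have h3 : ∑ i, ∑ j, x i * P i j * x j = ∑ j, (x ᵥ* P) j * x j := by
    rw [Finset.sum_comm]
    refine Finset.sum_congr rfl fun j _ => ?_
    simp only [Matrix.vecMul, dotProduct, Finset.sum_mul]
  have e : ∀ i j, P i j * (x i + x j) ^ 2 =
      P i j * x i ^ 2 + P i j * x j ^ 2 + 2 * (x i * P i j * x j) := fun i j => by ring
  simp_rw [e, Finset.sum_add_distrib, ← Finset.mul_sum, h1, h2, h3]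
  ring

lemma sum_sq_vecMul_le {P : Matrix X X ℝ} (hP : P ∈ doublyStochastic ℝ X) (x : X → ℝ) :
    ∑ j, (x ᵥ* P) j ^ 2 ≤ ∑ i, x i ^ 2 := by
  obtain ⟨h0, hr, hc⟩ := mem_doublyStochastic_iff_sum.1 hP
  have h : ∀ j, (x ᵥ* P) j ^ 2 ≤ ∑ i, P i j * x i ^ 2 := by
    intro j
    have := Finset.sum_sq_le_sum_mul_sum_of_sq_le_mul Finset.univ
      (r := fun i => x i * P i j) (f := fun i => P i j * x i ^ 2) (g := fun i => P i j)
      (fun i _ => mul_nonneg (h0 i j) (sq_nonneg _)) (fun i _ => h0 i j)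
      (fun i _ => le_of_eq (by ring))
    rw [hc j, mul_one] at this
    simpa only [Matrix.vecMul, dotProduct] using this
  refine (Finset.sum_le_sum fun j _ => h j).trans (le_of_eq ?_)
  rw [Finset.sum_comm]
  exact Finset.sum_congr rfl fun i _ => by rw [← Finset.sum_mul, hr, one_mul]

/-- A lazy doubly stochastic chain contracts at least as much as its Dirichlet form tells. -/
lemma sum_sq_vecMul_le_of_isLazy {P : Matrix X X ℝ} (hP : P ∈ doublyStochastic ℝ X)
    (hl : IsLazy P) (x : X → ℝ) :
    ∑ j, (x ᵥ* P) j ^ 2 ≤ ∑ j, (x ᵥ* P) j * x j := by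
  obtain ⟨h0, hr, hc⟩ := mem_doublyStochastic_iff_sum.1 hP
  -- Laziness makes `2 P - 1` doubly stochastic, hence an `ℓ²` contraction. Expanding its squared
  -- norm gives the claim without any symmetry of `P`.
  set Q : Matrix X X ℝ := (2 : ℝ) • P - 1 with hQ
  have hQs : Q ∈ doublyStochastic ℝ X := by
    refine mem_doublyStochastic_iff_sum.2 ⟨fun i j => ?_, fun i => ?_, fun j => ?_⟩
    · by_cases hij : i = j
      · subst hij
        have := hl i
        simp only [hQ, Matrix.sub_apply, Matrix.smul_apply, smul_eq_mul, Matrix.one_apply_eq]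
        linarith
      · simpa [hQ, Matrix.one_apply_ne hij] using h0 i j
    · simp [hQ, Finset.sum_sub_distrib, ← Finset.mul_sum, hr, Matrix.one_apply]; norm_num
    · simp [hQ, Finset.sum_sub_distrib, ← Finset.mul_sum, hc, Matrix.one_apply]; norm_num
  have h := sum_sq_vecMul_le hQs x
  have e : ∀ j, (x ᵥ* Q) j ^ 2 =
      4 * (x ᵥ* P) j ^ 2 - 4 * ((x ᵥ* P) j * x j) + x j ^ 2 := by
    intro j
    rw [hQ, Matrix.vecMul_sub, Matrix.vecMul_one, Matrix.vecMul_smul]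
    simp only [Pi.sub_apply, Pi.smul_apply, smul_eq_mul]
    ring
  simp_rw [e, Finset.sum_add_distrib, Finset.sum_sub_distrib, ← Finset.mul_sum] at h
  linarith

lemma sum_vecMul {P : Matrix X X ℝ} (hP : P ∈ doublyStochastic ℝ X) (x : X → ℝ) :
    ∑ j, (x ᵥ* P) j = ∑ i, x i := by
  obtain ⟨-, hr, -⟩ := mem_doublyStochastic_iff_sum.1 hP
  simp only [Matrix.vecMul, dotProduct]
  rw [Finset.sum_comm]
  exact Finset.sum_congr rfl fun i _ => by rw [← Finset.mul_sum, hr, mul_one]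

/-- A symmetric chain whose quadratic form is bounded by `c` on vectors of sum zero contracts
those vectors by the factor `c`. -/
lemma sum_sq_vecMul_le_of_symm {P : Matrix X X ℝ} (hP : P ∈ doublyStochastic ℝ X)
    (hs : ∀ i j, P i j = P j i) {c : ℝ} (hc : 0 < c)
    (h1 : ∀ x : X → ℝ, ∑ i, x i = 0 → ∑ j, (x ᵥ* P) j * x j ≤ c * ∑ i, x i ^ 2)
    (h2 : ∀ x : X → ℝ, ∑ i, x i = 0 → -(c * ∑ i, x i ^ 2) ≤ ∑ j, (x ᵥ* P) j * x j)
    (x : X → ℝ) (hx : ∑ i, x i = 0) :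
    ∑ j, (x ᵥ* P) j ^ 2 ≤ c ^ 2 * ∑ i, x i ^ 2 := by
  -- Polarization in place of diagonalization: the form at `x + y` is bounded above and at `x - y`
  -- below. By symmetry the difference is `4 * c⁻¹ * ∑ j, (x ᵥ* P) j ^ 2`. The scaling by `c⁻¹` is
  -- the choice that yields the sharp factor `c ^ 2`.
  set y : X → ℝ := c⁻¹ • (x ᵥ* P) with hy
  have hy0 : ∑ i, y i = 0 := by
    simp only [hy, Pi.smul_apply, smul_eq_mul, ← Finset.mul_sum, sum_vecMul hP, hx, mul_zero]
  have hadd := h1 (x + y) (by simp [Finset.sum_add_distrib, hx, hy0])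
  have hsub := h2 (x - y) (by simp [Finset.sum_sub_distrib, hx, hy0])
  have hswap : ∑ j, (y ᵥ* P) j * x j = ∑ j, (x ᵥ* P) j * y j := by
    simp only [Matrix.vecMul, dotProduct, Finset.sum_mul]
    rw [Finset.sum_comm]
    refine Finset.sum_congr rfl fun i _ => Finset.sum_congr rfl fun j _ => ?_
    rw [hs i j]; ring
  have hxy : ∑ j, (x ᵥ* P) j * y j = c⁻¹ * ∑ j, (x ᵥ* P) j ^ 2 := by
    rw [Finset.mul_sum]
    refine Finset.sum_congr rfl fun j _ => ?_
    simp only [hy, Pi.smul_apply, smul_eq_mul]; ring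
  have hyy : ∑ j, y j ^ 2 = c⁻¹ ^ 2 * ∑ j, (x ᵥ* P) j ^ 2 := by
    rw [Finset.mul_sum]
    refine Finset.sum_congr rfl fun j _ => ?_
    simp only [hy, Pi.smul_apply, smul_eq_mul]; ring
  have ea : ∑ j, ((x + y) ᵥ* P) j * (x + y) j = ∑ j, (x ᵥ* P) j * x j +
      ∑ j, (x ᵥ* P) j * y j + ∑ j, (y ᵥ* P) j * x j + ∑ j, (y ᵥ* P) j * y j := by
    simp only [Matrix.add_vecMul, Pi.add_apply, ← Finset.sum_add_distrib]
    exact Finset.sum_congr rfl fun j _ => by ring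
  have es : ∑ j, ((x - y) ᵥ* P) j * (x - y) j = ∑ j, (x ᵥ* P) j * x j -
      ∑ j, (x ᵥ* P) j * y j - ∑ j, (y ᵥ* P) j * x j + ∑ j, (y ᵥ* P) j * y j := by
    simp only [Matrix.sub_vecMul, Pi.sub_apply, ← Finset.sum_add_distrib,
      ← Finset.sum_sub_distrib]
    exact Finset.sum_congr rfl fun j _ => by ring
  have epar : ∑ i, (x + y) i ^ 2 + ∑ i, (x - y) i ^ 2 = 2 * (∑ i, x i ^ 2 + ∑ i, y i ^ 2) := by
    rw [← Finset.sum_add_distrib, ← Finset.sum_add_distrib, Finset.mul_sum]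
    refine Finset.sum_congr rfl fun j _ => ?_
    simp only [Pi.add_apply, Pi.sub_apply]; ring
  rw [ea] at hadd
  rw [es] at hsub
  rw [hswap, hxy] at hadd hsub
  rw [hyy] at epar
  set N := ∑ j, (x ᵥ* P) j ^ 2
  set M := ∑ i, x i ^ 2
  have h4 : 4 * (c⁻¹ * N) ≤ c * (2 * (M + c⁻¹ ^ 2 * N)) := by
    rw [← epar, mul_add]; linarith
  have e5 : c * (2 * (M + c⁻¹ ^ 2 * N)) = 2 * (c * M) + 2 * (c⁻¹ * N) := by
    field_simp
  have h6 : c⁻¹ * N ≤ c * M := by linarith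
  have h7 : c * (c⁻¹ * N) ≤ c * (c * M) := mul_le_mul_of_nonneg_left h6 hc.le
  rw [mul_inv_cancel_left₀ hc.ne'] at h7
  linarith

omit [DecidableEq X] in
lemma abs_sub_le_tvDist (μ ν : X → ℝ) (A : Finset X) :
    |∑ i ∈ A, μ i - ∑ i ∈ A, ν i| ≤ tvDist μ ν :=
  le_ciSup (f := fun A : Finset X => |∑ i ∈ A, μ i - ∑ i ∈ A, ν i|)
    (Set.finite_range _).bddAbove A

omit [DecidableEq X] in
lemma tvDist_le_sum_abs (μ ν : X → ℝ) : tvDist μ ν ≤ ∑ i, |μ i - ν i| := by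
  refine ciSup_le fun A => ?_
  rw [← Finset.sum_sub_distrib]
  refine (Finset.abs_sum_le_sum_abs _ _).trans ?_
  exact Finset.sum_le_sum_of_subset_of_nonneg (Finset.subset_univ _) fun _ _ _ => abs_nonneg _

/-- Contraction of mean-zero vectors forces uniqueness of the uniform distribution. Cauchy–Schwarz
passes from `ℓ²` to total variation at the price of the number of states, and the initial squared
distance is at most `2`; this is the form of `hT`. A single start that is far from uniform at all
times up to `lo` gives the other side. -/
lemma mixingTimeBetween_of_contraction [Nonempty X] {P : Matrix X X ℝ}
    (hP : P ∈ doublyStochastic ℝ X) {lam ε lo hi : ℝ} (hlam : 0 < lam) (hlam1 : lam ≤ 1)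
    (hε : 0 ≤ ε)
    (hc : ∀ x : X → ℝ, ∑ i, x i = 0 → ∑ j, (x ᵥ* P) j ^ 2 ≤ (1 - lam) * ∑ i, x i ^ 2)
    {T : ℕ} (hT : 2 * Fintype.card X * (1 - lam) ^ T ≤ ε ^ 2) (hThi : (T : ℝ) < hi)
    (hlo : ∃ σ ∈ stdSimplex ℝ X, ∀ k : ℕ, (k : ℝ) ≤ lo →
      ε < tvDist (σ ᵥ* P ^ k) (fun _ => (Fintype.card X : ℝ)⁻¹)) :
    MixingTimeBetween P ε lo hi := by
  obtain ⟨h0, hr, hcol⟩ := mem_doublyStochastic_iff_sum.1 hP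
  set π : X → ℝ := fun _ => (Fintype.card X : ℝ)⁻¹ with hπ
  have hn : (0 : ℝ) < Fintype.card X := by exact_mod_cast Fintype.card_pos
  have hπ1 : ∑ i, π i = 1 := by simp [hπ]
  have hπs : π ∈ stdSimplex ℝ X := ⟨fun i => by simp [hπ], hπ1⟩
  have hπP : π ᵥ* P = π := by
    ext j
    simp only [Matrix.vecMul, dotProduct, hπ, ← Finset.mul_sum, hcol, mul_one]
  have hπPk : ∀ k : ℕ, π ᵥ* P ^ k = π := by
    intro k
    induction k with
    | zero => simp
    | succ k ih => rw [pow_succ, ← Matrix.vecMul_vecMul, ih, hπP]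
  have hck : ∀ (x : X → ℝ), ∑ i, x i = 0 → ∀ k : ℕ,
      ∑ j, (x ᵥ* P ^ k) j ^ 2 ≤ (1 - lam) ^ k * ∑ i, x i ^ 2 ∧ ∑ j, (x ᵥ* P ^ k) j = 0 := by
    intro x hx k
    induction k with
    | zero => simp [hx]
    | succ k ih =>
      rw [pow_succ, ← Matrix.vecMul_vecMul]
      refine ⟨(hc _ ih.2).trans ?_, by rw [sum_vecMul hP, ih.2]⟩
      rw [pow_succ', mul_assoc]
      exact mul_le_mul_of_nonneg_left ih.1 (by linarith)
  refine ⟨π, ⟨hπs, hπP⟩, fun π' hπ' => ?_, ?_⟩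
  · have hx : ∑ i, (π' - π) i = 0 := by
      simp only [Pi.sub_apply, Finset.sum_sub_distrib, hπ'.1.2, hπ1, sub_self]
    have h := hc _ hx
    rw [Matrix.sub_vecMul, hπ'.2, hπP] at h
    have hs0 : 0 ≤ ∑ i, (π' - π) i ^ 2 := Finset.sum_nonneg fun _ _ => sq_nonneg _
    have hz : ∑ i, (π' - π) i ^ 2 = 0 := by nlinarith
    rw [Finset.sum_eq_zero_iff_of_nonneg (fun _ _ => sq_nonneg _)] at hz
    ext i
    have := hz i (Finset.mem_univ i)
    have := pow_eq_zero_iff (two_ne_zero) |>.1 this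
    simp only [Pi.sub_apply] at this
    linarith
  · have hub : mixingTime P π ε ≤ (T : ℕ∞) := by
      refine iSup₂_le fun σ hσ => iInf₂_le T ?_
      have hx : ∑ i, (σ - π) i = 0 := by
        simp only [Pi.sub_apply, Finset.sum_sub_distrib, hσ.2, hπ1, sub_self]
      obtain ⟨h1, -⟩ := hck _ hx T
      rw [Matrix.sub_vecMul, hπPk] at h1
      refine (tvDist_le_sum_abs _ _).trans ?_
      have hx2 : ∑ i, (σ - π) i ^ 2 ≤ 2 := by
        have hle : ∀ i, (σ - π) i ^ 2 ≤ σ i + π i := by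
          intro i
          have a1 := hσ.1 i
          have a2 := hπs.1 i
          have b1 : σ i ≤ 1 := hσ.2 ▸ Finset.single_le_sum (fun j _ => hσ.1 j) (Finset.mem_univ i)
          have b2 : π i ≤ 1 := hπs.2 ▸ Finset.single_le_sum (fun j _ => hπs.1 j) (Finset.mem_univ i)
          simp only [Pi.sub_apply]
          nlinarith [mul_nonneg a1 a2]
        refine (Finset.sum_le_sum fun i _ => hle i).trans ?_
        rw [Finset.sum_add_distrib, hσ.2, hπ1]; norm_num
      have hCS : (∑ i, |(σ ᵥ* P ^ T) i - π i|) ^ 2 ≤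
          Fintype.card X * ∑ i, ((σ ᵥ* P ^ T) i - π i) ^ 2 := by
        have := sq_sum_le_card_mul_sum_sq (s := Finset.univ)
          (f := fun i => |(σ ᵥ* P ^ T) i - π i|)
        simpa using this
      refine abs_le_of_sq_le_sq' ?_ hε |>.2
      refine hCS.trans ?_
      simp only [Pi.sub_apply] at h1 hx2
      have hpow : 0 ≤ (1 - lam) ^ T := pow_nonneg (by linarith) _
      calc (Fintype.card X : ℝ) * ∑ i, ((σ ᵥ* P ^ T) i - π i) ^ 2
          ≤ Fintype.card X * ((1 - lam) ^ T * 2) := by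
            refine mul_le_mul_of_nonneg_left (h1.trans ?_) hn.le
            exact mul_le_mul_of_nonneg_left hx2 hpow
        _ ≤ ε ^ 2 := by linarith
    obtain ⟨t, ht⟩ : ∃ t : ℕ, mixingTime P π ε = (t : ℕ∞) :=
      ⟨_, (ENat.natCast_toNat (ne_top_of_le_ne_top (ENat.natCast_ne_top T) hub)).symm⟩
    refine ⟨t, ht, ?_, ?_⟩
    · by_contra! hcon
      obtain ⟨σ, hσ, hk⟩ := hlo
      have hge : ((t + 1 : ℕ) : ℕ∞) ≤ mixingTime P π ε := by
        refine le_trans ?_ (le_iSup₂ (f := fun (σ : X → ℝ) (_ : σ ∈ stdSimplex ℝ X) =>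
          ⨅ (k : ℕ) (_ : tvDist (σ ᵥ* P ^ k) π ≤ ε), (k : ℕ∞)) σ hσ)
        refine le_iInf₂ fun k hkε => ?_
        by_contra! hlt
        have hlt' : k ≤ t := by
          have : k < t + 1 := by exact_mod_cast hlt
          omega
        have := hk k ((Nat.cast_le.2 hlt').trans hcon)
        linarith
      rw [ht] at hge
      have : t + 1 ≤ t := by exact_mod_cast hge
      omega
    · rw [ht] at hub
      have : t ≤ T := by exact_mod_cast hub
      exact (Nat.cast_le.2 this).trans_lt hThi

/-- A chain on which `f` grows at most by `η` per step in mean, started at a zero of `f`, is after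
`k` steps still in `{f < 1}` with probability at least `1 - k η`. -/
lemma one_sub_le_sum_vecMul_pow {P : Matrix X X ℝ} (hP : P ∈ doublyStochastic ℝ X)
    (f : X → ℝ) (hf : ∀ i, 0 ≤ f i) {η : ℝ} (hη : ∀ i, ∑ j, P i j * f j ≤ f i + η) {m : X}
    (hm : f m = 0) (A : Finset X) (hA : ∀ i ∉ A, 1 ≤ f i) (k : ℕ) :
    1 - k * η ≤ ∑ i ∈ A, (Pi.single m (1 : ℝ) ᵥ* P ^ k) i := by
  have hPk : ∀ k : ℕ, P ^ k ∈ doublyStochastic ℝ X := fun k => pow_mem hP k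
  have hfk : ∀ (k : ℕ) i, ∑ j, (P ^ k) i j * f j ≤ f i + k * η := by
    intro k
    induction k with
    | zero => intro i; simp [Matrix.one_apply]
    | succ k ih =>
      intro i
      obtain ⟨h0, hr, -⟩ := mem_doublyStochastic_iff_sum.1 (hPk k)
      have e : ∑ j, (P ^ (k + 1)) i j * f j = ∑ l, (P ^ k) i l * ∑ j, P l j * f j := by
        simp only [pow_succ, Matrix.mul_apply, Finset.sum_mul, Finset.mul_sum]
        rw [Finset.sum_comm]
        exact Finset.sum_congr rfl fun l _ => Finset.sum_congr rfl fun j _ => by ring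
      calc ∑ j, (P ^ (k + 1)) i j * f j ≤ ∑ l, (P ^ k) i l * (f l + η) := by
            rw [e]
            exact Finset.sum_le_sum fun l _ => mul_le_mul_of_nonneg_left (hη l) (h0 i l)
        _ = ∑ l, (P ^ k) i l * f l + η := by
            simp_rw [mul_add, Finset.sum_add_distrib, ← Finset.sum_mul, hr, one_mul]
        _ ≤ f i + (k + 1 : ℕ) * η := by
            have := ih i
            push_cast; linarith
  obtain ⟨h0, hr, -⟩ := mem_doublyStochastic_iff_sum.1 (hPk k)
  have e : ∀ i, (Pi.single m (1 : ℝ) ᵥ* P ^ k) i = (P ^ k) m i := by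
    intro i; simp
  simp_rw [e]
  have h1 := hfk k m
  -- Markov's inequality for `f` at time `k`.
  have h2 : ∑ j ∈ Aᶜ, (P ^ k) m j ≤ ∑ j, (P ^ k) m j * f j := by
    refine le_trans (Finset.sum_le_sum (g := fun j => (P ^ k) m j * f j) fun j hj => ?_)
      (Finset.sum_le_sum_of_subset_of_nonneg (Finset.subset_univ _)
        fun j _ _ => mul_nonneg (h0 m j) (hf j))
    have := hA j (by simpa using hj)
    nlinarith [h0 m j]
  have h3 := Finset.sum_add_sum_compl A (fun j => (P ^ k) m j)
  rw [hr] at h3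
  linarith

/-- The lower bound on the distance to the uniform distribution that follows from a slowly growing
function. -/
lemma lt_tvDist_of_slow {P : Matrix X X ℝ} (hP : P ∈ doublyStochastic ℝ X)
    (f : X → ℝ) (hf : ∀ i, 0 ≤ f i) {η : ℝ} (hη : ∀ i, ∑ j, P i j * f j ≤ f i + η) {m : X}
    (hm : f m = 0) (A : Finset X) (hA : ∀ i ∉ A, 1 ≤ f i) {k : ℕ} {ε : ℝ}
    (hk : k * η + A.card / Fintype.card X < 1 - ε) :
    ε < tvDist (Pi.single m (1 : ℝ) ᵥ* P ^ k) (fun _ => (Fintype.card X : ℝ)⁻¹) := by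
  refine lt_of_lt_of_le ?_ (abs_sub_le_tvDist _ _ A)
  refine lt_of_lt_of_le ?_ (le_abs_self _)
  have := one_sub_le_sum_vecMul_pow hP f hf hη hm A hA k
  simp only [Finset.sum_const, nsmul_eq_mul]
  rw [div_eq_mul_inv] at hk
  linarith

end Mixing

/-! ### The homogeneous chain -/

section Chain

variable {n : ℕ} (G : SimpleGraph (Fin n)) {qc ql r d : ℝ}

open Classical in
lemma sum_moveWeight_mul (f : Fin n → ℝ) (i : Fin n) :
    ∑ j, moveWeight G qc ql r d i j * f j =
      (qc + r) * f (finRotate n i) + (qc - r) * f ((finRotate n).symm i) +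
        ∑ j, (if G.Adj i j then ql / d else 0) * f j := by
  simp only [moveWeight, add_mul, Finset.sum_add_distrib]
  congr 1
  have h1 : ∀ j, (if j = finRotate n i then qc + r else 0) * f j =
      if j = finRotate n i then (qc + r) * f (finRotate n i) else 0 := by
    intro j; split_ifs with h
    · rw [h]
    · rw [zero_mul]
  have h2 : ∀ j, (if i = finRotate n j then qc - r else 0) * f j =
      if j = (finRotate n).symm i then (qc - r) * f ((finRotate n).symm i) else 0 := by
    intro j
    by_cases h : j = (finRotate n).symm i
    · rw [if_pos h, h, Equiv.apply_symm_apply, if_pos rfl]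
    · rw [if_neg h, if_neg, zero_mul]
      intro h'
      exact h ((Equiv.eq_symm_apply _).2 h'.symm)
  simp_rw [h1, h2]
  simp only [Finset.sum_ite_eq', Finset.mem_univ, if_true]
  ring

lemma sum_adj (c : ℝ) (i : Fin n) [DecidableRel G.Adj] :
    ∑ j, (if G.Adj i j then c else 0) = c * (G.neighborSet i).ncard := by
  rw [← Finset.sum_filter, Finset.sum_const, nsmul_eq_mul, mul_comm]
  congr 2
  rw [← Set.ncard_coe_finset]
  congr 1
  ext j; simp

lemma sum_moveWeight (i : Fin n) :
    ∑ j, moveWeight G qc ql r d i j = 2 * qc + ql / d * (G.neighborSet i).ncard := by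
  classical
  have := sum_moveWeight_mul G (qc := qc) (ql := ql) (r := r) (d := d) (fun _ => 1) i
  simp only [mul_one] at this
  rw [this, sum_adj]
  ring

open Classical in
lemma moveWeight_swap (i j : Fin n) :
    moveWeight G qc ql r d i j = moveWeight G qc ql (-r) d j i := by
  have h : (if G.Adj i j then ql / d else 0) = if G.Adj j i then ql / d else 0 :=
    if_congr (G.adj_comm i j) rfl rfl
  simp only [moveWeight, sub_neg_eq_add, ← sub_eq_add_neg]
  rw [h]
  ring

lemma moveWeight_nonneg (hr : |r| ≤ qc) (hql : 0 ≤ ql) (hd : 0 ≤ d) (i j : Fin n) :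
    0 ≤ moveWeight G qc ql r d i j := by
  obtain ⟨h1, h2⟩ := abs_le.1 hr
  unfold moveWeight
  refine add_nonneg (add_nonneg ?_ ?_) ?_
  · split_ifs <;> linarith
  · split_ifs <;> linarith
  · split_ifs
    · positivity
    · rfl

lemma sum_homogeneousChain_mul (f : Fin n → ℝ) (i : Fin n) :
    ∑ j, homogeneousChain G qc ql r d i j * f j =
      f i + ∑ j, moveWeight G qc ql r d i j * (f j - f i) := by
  simp only [homogeneousChain, Matrix.add_apply, add_mul, Finset.sum_add_distrib, mul_sub,
    Finset.sum_sub_distrib, Matrix.diagonal_apply, ite_mul, zero_mul, Finset.sum_ite_eq,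
    Finset.mem_univ, if_true, ← Finset.sum_mul]
  ring

variable {G}

lemma moveWeight_sum_le (hql : 0 ≤ ql) (hd : 0 < d)
    (hdeg : ∀ v, ((G.neighborSet v).ncard : ℝ) ≤ d) (i : Fin n) :
    ∑ j, moveWeight G qc ql r d i j ≤ 2 * qc + ql := by
  rw [sum_moveWeight]
  have : ql / d * (G.neighborSet i).ncard ≤ ql / d * d :=
    mul_le_mul_of_nonneg_left (hdeg i) (by positivity)
  rw [div_mul_cancel₀ _ hd.ne'] at this
  linarith

lemma le_homogeneousChain_diag (hr : |r| ≤ qc) (hql : 0 ≤ ql) (hd : 0 ≤ d) (i : Fin n) :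
    1 - ∑ j, moveWeight G qc ql r d i j ≤ homogeneousChain G qc ql r d i i := by
  simp only [homogeneousChain, Matrix.add_apply, Matrix.diagonal_apply_eq]
  linarith [moveWeight_nonneg G hr hql hd i i]

lemma homogeneousChain_ne {i j : Fin n} (h : i ≠ j) :
    homogeneousChain G qc ql r d i j = moveWeight G qc ql r d i j := by
  simp [homogeneousChain, Matrix.diagonal_apply_ne _ h]

/-- Transposing the move weights reverses the drift, and the total weight at a node does not depend
on the drift. So incoming and outgoing weights agree at every node. -/
lemma homogeneousChain_mem_doublyStochastic (hr : |r| ≤ qc) (hql : 0 ≤ ql)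
    (hq : 2 * qc + ql ≤ 1) (hd : 0 < d) (hdeg : ∀ v, ((G.neighborSet v).ncard : ℝ) ≤ d) :
    homogeneousChain G qc ql r d ∈ doublyStochastic ℝ (Fin n) := by
  refine mem_doublyStochastic_iff_sum.2 ⟨fun i j => ?_, fun i => ?_, fun j => ?_⟩
  · by_cases h : i = j
    · subst h
      refine le_trans ?_ (le_homogeneousChain_diag hr hql hd.le i)
      linarith [moveWeight_sum_le (qc := qc) (r := r) hql hd hdeg i]
    · rw [homogeneousChain_ne h]
      exact moveWeight_nonneg G hr hql hd.le i j
  · have := sum_homogeneousChain_mul G (qc := qc) (ql := ql) (r := r) (d := d) (fun _ => 1) i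
    simpa using this
  · simp only [homogeneousChain, Matrix.add_apply, Finset.sum_add_distrib, Matrix.diagonal_apply,
      Finset.sum_ite_eq', Finset.mem_univ, if_true]
    rw [sum_moveWeight]
    simp_rw [moveWeight_swap G _ j]
    rw [sum_moveWeight]
    ring

lemma homogeneousChain_isLazy (hr : |r| ≤ qc) (hql : 0 ≤ ql)
    (hq : 2 * qc + ql ≤ 1 / 2) (hd : 0 < d) (hdeg : ∀ v, ((G.neighborSet v).ncard : ℝ) ≤ d) :
    IsLazy (homogeneousChain G qc ql r d) := by
  intro i
  refine le_trans ?_ (le_homogeneousChain_diag hr hql hd.le i)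
  linarith [moveWeight_sum_le (qc := qc) (r := r) hql hd hdeg i]

lemma homogeneousChain_symm (i j : Fin n) :
    homogeneousChain G qc ql 0 d i j = homogeneousChain G qc ql 0 d j i := by
  by_cases h : i = j
  · rw [h]
  · rw [homogeneousChain_ne h, homogeneousChain_ne (Ne.symm h), moveWeight_swap, neg_zero]

/-- The drift does not contribute to the Dirichlet form. -/
lemma dirichlet_homogeneousChain (x : Fin n → ℝ) :
    ∑ i, ∑ j, homogeneousChain G qc ql r d i j * (x i - x j) ^ 2 =
      ∑ i, ∑ j, moveWeight G qc ql 0 d i j * (x i - x j) ^ 2 := by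
  have h1 : ∀ i j, homogeneousChain G qc ql r d i j * (x i - x j) ^ 2 =
      moveWeight G qc ql r d i j * (x i - x j) ^ 2 := by
    intro i j
    by_cases h : i = j
    · simp [h]
    · rw [homogeneousChain_ne h]
  have h2 : ∀ i j, 2 * moveWeight G qc ql 0 d i j =
      moveWeight G qc ql r d i j + moveWeight G qc ql r d j i := by
    intro i j
    rw [moveWeight_swap G j i]
    unfold moveWeight
    split_ifs <;> ring
  simp_rw [h1]
  have h3 : ∑ i, ∑ j, moveWeight G qc ql r d j i * (x i - x j) ^ 2 =
      ∑ i, ∑ j, moveWeight G qc ql r d i j * (x i - x j) ^ 2 := by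
    rw [Finset.sum_comm]
    exact Finset.sum_congr rfl fun i _ => Finset.sum_congr rfl fun j _ => by ring
  have h4 : 2 * ∑ i, ∑ j, moveWeight G qc ql 0 d i j * (x i - x j) ^ 2 =
      ∑ i, ∑ j, moveWeight G qc ql r d i j * (x i - x j) ^ 2 +
      ∑ i, ∑ j, moveWeight G qc ql r d j i * (x i - x j) ^ 2 := by
    simp_rw [Finset.mul_sum, ← Finset.sum_add_distrib]
    exact Finset.sum_congr rfl fun i _ => Finset.sum_congr rfl fun j _ => by
      rw [← add_mul, ← h2]; ring
  rw [h3] at h4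
  linarith

/-- The nodes `i` such that the cycle edge from `i` to its successor leaves or enters `S`. -/
def cycleBoundary (S : Finset (Fin n)) : Finset (Fin n) :=
  Finset.univ.filter fun i => ¬ (i ∈ S ↔ finRotate n i ∈ S)

/-- The pairs with one element in `S` and the other outside. -/
def cutPairs (S : Finset (Fin n)) : Finset (Sym2 (Fin n)) :=
  (S ×ˢ Sᶜ).image fun a => s(a.1, a.2)

lemma cutPairs_injOn (S : Finset (Fin n)) :
    Set.InjOn (fun a : Fin n × Fin n => s(a.1, a.2)) (S ×ˢ Sᶜ : Finset (Fin n × Fin n)) := by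
  rintro ⟨a, b⟩ h1 ⟨a', b'⟩ h2 h
  simp only [Finset.coe_product, Set.mem_prod, Finset.mem_coe, Finset.mem_compl] at h1 h2
  simp only [Sym2.eq_iff] at h
  rcases h with ⟨rfl, rfl⟩ | ⟨rfl, rfl⟩
  · rfl
  · exact absurd h1.1 h2.2

lemma card_cutPairs (S : Finset (Fin n)) : (cutPairs S).card = S.card * Sᶜ.card := by
  rw [cutPairs, Finset.card_image_of_injOn (cutPairs_injOn S), Finset.card_product]

lemma cutPairs_not_isDiag (S : Finset (Fin n)) : ∀ e ∈ cutPairs S, ¬ e.IsDiag := by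
  intro e he
  simp only [cutPairs, Finset.mem_image, Finset.mem_product, Finset.mem_compl] at he
  obtain ⟨⟨a, b⟩, ⟨h1, h2⟩, rfl⟩ := he
  simp only [Sym2.mk_isDiag_iff]
  rintro rfl
  exact h2 h1

/-- Without drift, a cycle edge crossing the cut has weight `qc` whether it leaves or enters `S`
clockwise. These two kinds of edges partition the cycle boundary. -/
lemma sum_cut_moveWeight (S : Finset (Fin n)) :
    ∑ i ∈ S, ∑ j ∈ Sᶜ, moveWeight G qc ql 0 d i j =
      qc * (cycleBoundary S).card + ql / d * edgesIn G (cutPairs S) := by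
  classical
  simp only [moveWeight, add_zero, sub_zero, Finset.sum_add_distrib]
  congr 1
  · have h1 : ∑ i ∈ S, ∑ j ∈ Sᶜ, (if j = finRotate n i then qc else 0) =
        qc * (S.filter fun i => finRotate n i ∉ S).card := by
      simp_rw [Finset.sum_ite_eq', Finset.mem_compl]
      rw [← Finset.sum_filter, Finset.sum_const, nsmul_eq_mul, mul_comm]
    have h2 : ∑ i ∈ S, ∑ j ∈ Sᶜ, (if i = finRotate n j then qc else 0) =
        qc * (Sᶜ.filter fun i => finRotate n i ∈ S).card := by
      rw [Finset.sum_comm]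
      simp_rw [Finset.sum_ite_eq']
      rw [← Finset.sum_filter, Finset.sum_const, nsmul_eq_mul, mul_comm]
    rw [h1, h2, ← mul_add, ← Nat.cast_add, ← Finset.card_union_of_disjoint]
    · congr 3
      ext i
      simp only [cycleBoundary, Finset.mem_union, Finset.mem_filter, Finset.mem_compl,
        Finset.mem_univ, true_and]
      tauto
    · rw [Finset.disjoint_left]
      intro i hi hi'
      simp only [Finset.mem_filter, Finset.mem_compl] at hi hi'
      exact hi'.1 hi.1
  · rw [edgesIn, cutPairs, Finset.filter_image,
      Finset.card_image_of_injOn ((cutPairs_injOn S).mono (by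
        intro x hx; exact Finset.mem_of_mem_filter _ hx)),
      ← Finset.sum_product', ← Finset.sum_filter, Finset.sum_const, nsmul_eq_mul, mul_comm]
    simp only [SimpleGraph.mem_edgeSet]

/-- The spectral gap of the homogeneous chain in terms of its conductance. -/
lemma sum_vecMul_mul_le (hqc : 0 ≤ qc) (hr : |r| ≤ qc) (hql : 0 ≤ ql)
    (hq : 2 * qc + ql ≤ 1) (hd : 0 < d) (hdeg : ∀ v, ((G.neighborSet v).ncard : ℝ) ≤ d)
    {φ : ℝ} (hφ : 0 ≤ φ)
    (hcut : ∀ S : Finset (Fin n), 2 * S.card ≤ n →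
      φ * S.card ≤ qc * (cycleBoundary S).card ∨ φ * S.card ≤ ql / d * edgesIn G (cutPairs S))
    (x : Fin n → ℝ) (hx : ∑ i, x i = 0) :
    ∑ j, (x ᵥ* homogeneousChain G qc ql r d) j * x j ≤ (1 - φ ^ 2 / 2) * ∑ i, x i ^ 2 := by
  have h0 : |(0 : ℝ)| ≤ qc := by simpa using hqc
  have h1 := dirichlet_eq (homogeneousChain_mem_doublyStochastic hr hql hq hd hdeg) x
  rw [dirichlet_homogeneousChain] at h1
  have h2 := cheeger (w := moveWeight G qc ql 0 d) (moveWeight_nonneg G h0 hql hd.le)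
    (fun i j => by rw [moveWeight_swap, neg_zero])
    (fun i => (moveWeight_sum_le hql hd hdeg i).trans hq) hφ (fun S hS => by
      rw [sum_cut_moveWeight]
      have b1 : 0 ≤ qc * (cycleBoundary S).card := by positivity
      have b2 : 0 ≤ ql / d * edgesIn G (cutPairs S) := by positivity
      rcases hcut S (by simpa using hS) with h | h <;> linarith) x hx
  linarith

/-- If every node reaches a node without long range edges by less than `l` clockwise steps, the
spectrum of the reversible chain stays away from `-1`. -/
lemma neg_le_sum_vecMul_mul (hn : 2 ≤ n) (hqc : 0 ≤ qc) (hql : 0 ≤ ql)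
    (hq : 2 * qc + ql ≤ 1) (hd : 0 < d) (hdeg : ∀ v, ((G.neighborSet v).ncard : ℝ) ≤ d)
    {l : ℕ} (hl : ∀ i : Fin n, ∃ k < l, G.neighborSet ((finRotate n ^ k) i) = ∅)
    {δ : ℝ} (hδ : 0 ≤ δ) (hδc : δ * l ^ 2 ≤ qc) (hδl : δ * l ^ 2 ≤ ql)
    (x : Fin n → ℝ) :
    -((1 - δ / 2) * ∑ i, x i ^ 2) ≤ ∑ j, (x ᵥ* homogeneousChain G qc ql 0 d) j * x j := by
  classical
  have h0 : |(0 : ℝ)| ≤ qc := by simpa using hqc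
  have hP := homogeneousChain_mem_doublyStochastic h0 hql hq hd hdeg
  have h1 := dirichlet_add_eq hP x
  set P := homogeneousChain G qc ql 0 d with hPdef
  set ρ := finRotate n with hρ
  have hρi : ∀ i, i ≠ ρ i := by
    intro i hi
    obtain ⟨m, rfl⟩ : ∃ m, n = m + 2 := ⟨n - 2, by omega⟩
    rw [hρ, finRotate_apply] at hi
    simp at hi
  -- Local energy available at a node: the cycle edge to its successor and, if there are no long
  -- range edges, the holding probability. The latter is then at least `1 - 2 * qc ≥ ql`.
  set g : Fin n → ℝ := fun i =>
    (if G.neighborSet i = ∅ then x i ^ 2 else 0) + (x i + x (ρ i)) ^ 2 with hg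
  have hg0 : ∀ i, 0 ≤ g i := fun i => by
    simp only [hg]; split_ifs <;> positivity
  have hlow : δ * l ^ 2 * ∑ i, g i ≤ ∑ i, ∑ j, P i j * (x i + x j) ^ 2 := by
    rw [Finset.mul_sum]
    refine Finset.sum_le_sum fun i _ => ?_
    have hsub : ∑ j ∈ {i, ρ i}, P i j * (x i + x j) ^ 2 ≤ ∑ j, P i j * (x i + x j) ^ 2 :=
      Finset.sum_le_sum_of_subset_of_nonneg (Finset.subset_univ _)
        fun j _ _ => mul_nonneg (nonneg_of_mem_doublyStochastic hP) (sq_nonneg _)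
    rw [Finset.sum_pair (hρi i)] at hsub
    refine le_trans ?_ hsub
    have hc : qc ≤ P i (ρ i) := by
      rw [hPdef, homogeneousChain_ne (hρi i)]
      simp only [moveWeight, hρ, if_true, add_zero, sub_zero]
      have a1 : 0 ≤ (if i = finRotate n (finRotate n i) then qc else 0) := by
        split_ifs <;> simp [hqc]
      have a2 : 0 ≤ (if G.Adj i (finRotate n i) then ql / d else 0) := by
        split_ifs
        · positivity
        · rfl
      linarith
    have hdiag : (if G.neighborSet i = ∅ then ql else 0) ≤ P i i := by
      split_ifs with h
      · refine le_trans ?_ (le_homogeneousChain_diag h0 hql hd.le i)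
        rw [sum_moveWeight, h]
        simp; linarith
      · exact nonneg_of_mem_doublyStochastic hP
    have e1 : δ * l ^ 2 * (x i + x (ρ i)) ^ 2 ≤ P i (ρ i) * (x i + x (ρ i)) ^ 2 :=
      mul_le_mul_of_nonneg_right (hδc.trans hc) (sq_nonneg _)
    have e2 : δ * l ^ 2 * (if G.neighborSet i = ∅ then x i ^ 2 else 0) ≤
        P i i * (x i + x i) ^ 2 := by
      split_ifs at hdiag ⊢ with h
      · have : δ * l ^ 2 * x i ^ 2 ≤ P i i * x i ^ 2 :=
          mul_le_mul_of_nonneg_right (hδl.trans hdiag) (sq_nonneg _)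
        nlinarith [mul_nonneg (hql.trans hdiag) (sq_nonneg (x i))]
      · rw [mul_zero]; positivity
    simp only [hg, mul_add]
    linarith
  -- Telescoping with alternating signs: a vector that nearly changes sign at each step has nearly
  -- constant absolute value, so its size at `i` is passed on to the free node, where holding
  -- penalizes it.
  have habs : ∀ (k : ℕ) i, |x i| ≤
      |x ((ρ ^ k) i)| + ∑ t ∈ Finset.range k, |x ((ρ ^ t) i) + x (ρ ((ρ ^ t) i))| := by
    intro k i
    induction k with
    | zero => simp
    | succ k ih =>
      rw [Finset.sum_range_succ, pow_succ', Equiv.Perm.mul_apply]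
      have := abs_sub_abs_le_abs_add (x ((ρ ^ k) i)) (x (ρ ((ρ ^ k) i)))
      linarith
  have hpath : ∀ i, x i ^ 2 ≤ l * ∑ t ∈ Finset.range l, g ((ρ ^ t) i) := by
    intro i
    obtain ⟨k, hk, hfree⟩ := hl i
    set b : ℕ → ℝ := fun t =>
      if t < k then |x ((ρ ^ t) i) + x (ρ ((ρ ^ t) i))| else |x ((ρ ^ t) i)| with hb
    have hsum : |x i| ≤ ∑ t ∈ Finset.range (k + 1), b t := by
      rw [Finset.sum_range_succ]
      have e : ∑ t ∈ Finset.range k, b t =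
          ∑ t ∈ Finset.range k, |x ((ρ ^ t) i) + x (ρ ((ρ ^ t) i))| :=
        Finset.sum_congr rfl fun t ht => by simp [hb, Finset.mem_range.1 ht]
      rw [e]
      have := habs k i
      simp only [hb, lt_irrefl, if_false]
      linarith
    have hbg : ∀ t ∈ Finset.range (k + 1), b t ^ 2 ≤ g ((ρ ^ t) i) := by
      intro t ht
      simp only [hb, hg]
      rcases (Finset.mem_range_succ_iff.1 ht).lt_or_eq with h | h
      · simp only [h, if_true, sq_abs]
        have : 0 ≤ (if G.neighborSet ((ρ ^ t) i) = ∅ then x ((ρ ^ t) i) ^ 2 else 0) := by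
          split_ifs <;> positivity
        linarith
      · subst h
        simp only [lt_irrefl, if_false, hfree, if_true, sq_abs]
        linarith [sq_nonneg (x ((ρ ^ t) i) + x (ρ ((ρ ^ t) i)))]
    have hCS := sq_sum_le_card_mul_sum_sq (s := Finset.range (k + 1)) (f := b)
    rw [Finset.card_range] at hCS
    calc x i ^ 2 = |x i| ^ 2 := (sq_abs _).symm
      _ ≤ (∑ t ∈ Finset.range (k + 1), b t) ^ 2 := pow_le_pow_left₀ (abs_nonneg _) hsum 2
      _ ≤ ((k + 1 : ℕ) : ℝ) * ∑ t ∈ Finset.range (k + 1), b t ^ 2 := hCS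
      _ ≤ (l : ℝ) * ∑ t ∈ Finset.range l, g ((ρ ^ t) i) := by
        refine mul_le_mul (by exact_mod_cast hk) ?_
          (Finset.sum_nonneg fun _ _ => sq_nonneg _) (Nat.cast_nonneg _)
        refine (Finset.sum_le_sum hbg).trans ?_
        exact Finset.sum_le_sum_of_subset_of_nonneg
          (Finset.range_subset_range.2 hk) fun _ _ _ => hg0 _
  -- Rotations permute the nodes, so each local energy is counted `l` times; the second factor `l`
  -- comes from Cauchy–Schwarz along a path.
  have htot : ∑ i, x i ^ 2 ≤ l ^ 2 * ∑ i, g i := by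
    refine (Finset.sum_le_sum fun i _ => hpath i).trans (le_of_eq ?_)
    rw [← Finset.mul_sum, Finset.sum_comm]
    have : ∀ t ∈ Finset.range l, ∑ i, g ((ρ ^ t) i) = ∑ i, g i :=
      fun t _ => Equiv.sum_comp (ρ ^ t) g
    rw [Finset.sum_congr rfl this, Finset.sum_const, Finset.card_range, nsmul_eq_mul]
    ring
  have : δ * ∑ i, x i ^ 2 ≤ δ * (l ^ 2 * ∑ i, g i) := mul_le_mul_of_nonneg_left htot hδ
  linarith

/-- A profile `g` centred in an arc without long range edges gives a slow start of the chain. -/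
lemma lt_tvDist_of_arc (hr : |r| ≤ qc) (hql : 0 ≤ ql)
    (hq : 2 * qc + ql ≤ 1) (hd : 0 < d) (hdeg : ∀ v, ((G.neighborSet v).ncard : ℝ) ≤ d)
    {a L h : ℕ} (ha : a + L ≤ n) (hL : 2 * h + 1 ≤ L)
    (hfree : ∀ i : Fin n, a ≤ i → (i : ℕ) < a + L → G.neighborSet i = ∅)
    {g : ℝ → ℝ} {η : ℝ} (hη0 : 0 ≤ η) (hg0 : ∀ u, 0 ≤ g u) (hgz : g 0 = 0)
    (hg1 : ∀ u : ℝ, (h : ℝ) ≤ |u| → 1 ≤ g u)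
    (hg : ∀ u : ℝ, |u| < (h : ℝ) → g u ≤ 1 ∧
      (qc + r) * (g (u + 1) - g u) + (qc - r) * (g (u - 1) - g u) ≤ η)
    {ε : ℝ} : ∃ m : Fin n, ∀ k : ℕ, k * η + (L : ℝ) / n < 1 - ε → ε < tvDist (Pi.single m (1 : ℝ) ᵥ* homogeneousChain G qc ql r d ^ k)
      (fun _ => (Fintype.card (Fin n) : ℝ)⁻¹) := by
  classical
  obtain ⟨hr1, hr2⟩ := abs_le.1 hr
  have hP := homogeneousChain_mem_doublyStochastic hr hql hq hd hdeg
  -- Centre the profile at `a + h` and cap it at `1`. Where the cap is active the mean of `f` cannot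
  -- increase, so only nodes at distance less than `h` from the centre need the hypothesis on `g`.
  set f : Fin n → ℝ := fun i => min 1 (g ((i : ℕ) - ((a + h : ℕ) : ℝ))) with hf
  refine ⟨⟨a + h, by omega⟩, fun k hk => lt_tvDist_of_slow hP f (fun i => le_min zero_le_one (hg0 _))
    (η := η) (fun i => ?_) (by simp [hf, hgz])
    (Finset.univ.filter fun i : Fin n => a ≤ i ∧ (i : ℕ) < a + L) (fun i hi => ?_)
    (lt_of_le_of_lt ?_ hk)⟩
  · have hf1 : ∀ j, f j ≤ 1 := fun j => min_le_left _ _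
    by_cases hi : |((i : ℕ) : ℝ) - ((a + h : ℕ) : ℝ)| < h
    · obtain ⟨hg1', hg2⟩ := hg _ hi
      have hfi : f i = g ((i : ℕ) - ((a + h : ℕ) : ℝ)) := min_eq_right hg1'
      obtain ⟨hi1, hi2⟩ := abs_lt.1 hi
      have hi1' : a < i := by
        have : (a : ℝ) < (i : ℕ) := by push_cast at hi1; linarith
        exact_mod_cast this
      have hi2' : (i : ℕ) < a + 2 * h := by
        have : ((i : ℕ) : ℝ) < a + 2 * h := by push_cast at hi2; linarith
        exact_mod_cast this
      -- The node `i` lies strictly inside the arc, so its steps on the cycle do not wrap around and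
      -- change the integer coordinate by exactly one.
      have hρ : ∀ j : Fin n, (j : ℕ) + 1 < n → ((finRotate n j : Fin n) : ℕ) = j + 1 := by
        intro j hj
        obtain ⟨m, rfl⟩ : ∃ m, n = m + 1 := ⟨n - 1, by omega⟩
        exact coe_finRotate_of_ne_last (by
          intro h; rw [h, Fin.val_last] at hj; omega)
      have hup : f (finRotate n i) ≤ g ((i : ℕ) - ((a + h : ℕ) : ℝ) + 1) := by
        refine (min_le_right _ _).trans (le_of_eq ?_)
        rw [hρ i (by omega)]
        congr 1; push_cast; ring
      have hdown : f ((finRotate n).symm i) ≤ g ((i : ℕ) - ((a + h : ℕ) : ℝ) - 1) := by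
        have e : (finRotate n).symm i = ⟨i - 1, by omega⟩ := by
          rw [Equiv.symm_apply_eq]
          apply Fin.ext
          rw [hρ _ (by simp only; omega)]
          simp only; omega
        rw [e]
        refine (min_le_right _ _).trans (le_of_eq ?_)
        congr 1
        rw [Nat.cast_sub (by omega)]; push_cast; ring
      have hnb : ∀ j, ¬ G.Adj i j := by
        intro j hj
        have := hfree i hi1'.le (by omega)
        exact (Set.eq_empty_iff_forall_notMem.1 this) j hj
      rw [sum_homogeneousChain_mul, sum_moveWeight_mul]
      simp only [hnb, if_false, zero_mul, Finset.sum_const_zero, add_zero]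
      have e1 : (qc + r) * (f (finRotate n i) - f i) ≤
          (qc + r) * (g ((i : ℕ) - ((a + h : ℕ) : ℝ) + 1) - g ((i : ℕ) - ((a + h : ℕ) : ℝ))) :=
        mul_le_mul_of_nonneg_left (by linarith) (by linarith)
      have e2 : (qc - r) * (f ((finRotate n).symm i) - f i) ≤
          (qc - r) * (g ((i : ℕ) - ((a + h : ℕ) : ℝ) - 1) - g ((i : ℕ) - ((a + h : ℕ) : ℝ))) :=
        mul_le_mul_of_nonneg_left (by linarith) (by linarith)
      linarith
    · have hfi : f i = 1 := min_eq_left (hg1 _ (not_lt.1 hi))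
      calc ∑ j, homogeneousChain G qc ql r d i j * f j
          ≤ ∑ j, homogeneousChain G qc ql r d i j * 1 :=
            Finset.sum_le_sum fun j _ =>
              mul_le_mul_of_nonneg_left (hf1 j) (nonneg_of_mem_doublyStochastic hP)
        _ = 1 := by simp only [mul_one]; exact sum_row_of_mem_doublyStochastic hP i
        _ ≤ f i + η := by linarith
  · refine le_min le_rfl (hg1 _ ?_)
    simp only [Finset.mem_filter, Finset.mem_univ, true_and, not_and, not_lt] at hi
    rcases lt_or_ge (i : ℕ) a with h' | h'
    · have : ((i : ℕ) : ℝ) < a := by exact_mod_cast h'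
      rw [abs_of_neg (by push_cast; linarith [Nat.cast_nonneg (α := ℝ) h])]
      push_cast; linarith
    · have h2 : ((a + (2 * h + 1) : ℕ) : ℝ) ≤ (i : ℕ) := by
        exact_mod_cast (Nat.add_le_add_left hL a).trans (hi h')
      push_cast at h2
      have := Nat.cast_nonneg (α := ℝ) h
      rw [abs_of_nonneg (by push_cast; linarith)]
      push_cast; linarith
  · rw [Fintype.card_fin]
    gcongr
    have := Finset.card_le_card_of_injOn (s := Finset.univ.filter
      fun i : Fin n => a ≤ i ∧ (i : ℕ) < a + L) (t := Finset.Ico a (a + L)) (fun i => (i : ℕ))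
      (fun i hi => by simpa using hi) (fun i _ j _ hij => Fin.ext hij)
    simpa using this

end Chain

/-! ### Sets of nodes and the long range edges at them -/

section NodeSets

variable {n : ℕ}

/-- Walking clockwise from `0`, the boundary records exactly where membership flips. Hence a set is
encoded by its boundary and one bit. -/
lemma mem_iff_of_cycleBoundary_eq {m : ℕ} {S S' : Finset (Fin (m + 1))}
    (h : cycleBoundary S = cycleBoundary S') (h0 : 0 ∈ S ↔ 0 ∈ S') (i : Fin (m + 1)) :
    i ∈ S ↔ i ∈ S' := by
  induction i using Fin.induction with
  | zero => exact h0
  | succ i ih =>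
    have h1 : i.castSucc ∈ cycleBoundary S ↔ i.castSucc ∈ cycleBoundary S' := by rw [h]
    simp only [cycleBoundary, Finset.mem_filter, Finset.mem_univ, true_and] at h1
    have h2 : finRotate (m + 1) i.castSucc = i.succ := by
      rw [finRotate_apply, Fin.coeSucc_eq_succ]
    rw [h2] at h1
    tauto

lemma cycleBoundary_nonempty {S : Finset (Fin n)} (hne : S.Nonempty) (hS : 2 * S.card ≤ n) :
    (cycleBoundary S).Nonempty := by
  obtain ⟨i, hi⟩ := hne
  obtain ⟨m, rfl⟩ : ∃ m, n = m + 1 := ⟨n - 1, by have := i.2; omega⟩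
  rw [Finset.nonempty_iff_ne_empty]
  intro h
  by_cases h0 : 0 ∈ S
  · have hu : S = Finset.univ := by
      ext j
      exact mem_iff_of_cycleBoundary_eq (by rw [h]; simp [cycleBoundary]) (by simpa using h0) j
    rw [hu] at hS
    simp at hS
  · have := (mem_iff_of_cycleBoundary_eq (S' := ∅) (by rw [h]; simp [cycleBoundary])
      (by simpa using h0) i).1 hi
    simp at this

/-- At most two sets share a boundary, so the sum is at most twice a binomial expansion without the
empty subset. This is the entropy estimate for the union bound over cuts. -/
lemma sum_pow_cycleBoundary_le (hn : 0 < n) {x : ℝ} (hx : 0 ≤ x) :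
    ∑ S : Finset (Fin n) with (cycleBoundary S).Nonempty, x ^ (cycleBoundary S).card ≤
      2 * ((1 + x) ^ n - 1) := by
  classical
  obtain ⟨m, rfl⟩ : ∃ m, n = m + 1 := ⟨n - 1, by omega⟩
  set A : Finset (Finset (Fin (m + 1))) := Finset.univ.filter fun S => (cycleBoundary S).Nonempty
  set B : Finset (Finset (Fin (m + 1)) × Bool) :=
    (Finset.univ.erase ∅) ×ˢ Finset.univ
  have hB : ∑ b ∈ B, x ^ b.1.card = 2 * ((1 + x) ^ (m + 1) - 1) := by
    have h1 : ∑ t : Finset (Fin (m + 1)), x ^ t.card = (1 + x) ^ (m + 1) := by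
      have := Finset.sum_pow_mul_eq_add_pow x 1 (Finset.univ : Finset (Fin (m + 1)))
      simpa [add_comm] using this
    have h2 := Finset.add_sum_erase Finset.univ
      (fun t : Finset (Fin (m + 1)) => x ^ t.card) (Finset.mem_univ ∅)
    simp only [Finset.card_empty, pow_zero] at h2
    rw [Finset.sum_product]
    simp only [Finset.sum_const, Finset.card_univ, Fintype.card_bool, nsmul_eq_mul,
      ← Finset.mul_sum]
    rw [← h1, ← h2]; push_cast; ring
  rw [← hB]
  set F : Finset (Fin (m + 1)) → Finset (Fin (m + 1)) × Bool :=
    fun S => (cycleBoundary S, decide (0 ∈ S)) with hF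
  have hinj : Set.InjOn F A := by
    intro S _ S' _ h
    simp only [hF, Prod.mk.injEq, decide_eq_decide] at h
    ext i
    exact mem_iff_of_cycleBoundary_eq h.1 h.2 i
  calc ∑ S ∈ A, x ^ (cycleBoundary S).card = ∑ b ∈ A.image F, x ^ b.1.card := by
        rw [Finset.sum_image hinj]
    _ ≤ ∑ b ∈ B, x ^ b.1.card := by
        refine Finset.sum_le_sum_of_subset_of_nonneg ?_ fun _ _ _ => by positivity
        intro b hb
        obtain ⟨S, hS, rfl⟩ := Finset.mem_image.1 hb
        have : (cycleBoundary S).Nonempty := by simpa [A] using hS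
        simp [B, hF, this.ne_empty, em]

/-- The pairs of distinct nodes that meet `A`. -/
def touchPairs (A : Finset (Fin n)) : Finset (Sym2 (Fin n)) :=
  ((A ×ˢ Finset.univ).image fun a => s(a.1, a.2)).filter fun e => ¬ e.IsDiag

lemma touchPairs_not_isDiag (A : Finset (Fin n)) : ∀ e ∈ touchPairs A, ¬ e.IsDiag :=
  fun _ he => (Finset.mem_filter.1 he).2

lemma card_touchPairs_le (A : Finset (Fin n)) : (touchPairs A).card ≤ A.card * n := by
  refine (Finset.card_filter_le _ _).trans (Finset.card_image_le.trans ?_)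
  rw [Finset.card_product, Finset.card_fin]

lemma mem_touchPairs {A : Finset (Fin n)} {i j : Fin n} (hi : i ∈ A) (hij : i ≠ j) :
    s(i, j) ∈ touchPairs A := by
  simp only [touchPairs, Finset.mem_filter, Finset.mem_image, Finset.mem_product,
    Finset.mem_univ, and_true, Sym2.mk_isDiag_iff]
  exact ⟨⟨(i, j), hi, rfl⟩, hij⟩

lemma card_touchPairs_inter_le {A B : Finset (Fin n)} (h : Disjoint A B) :
    (touchPairs A ∩ touchPairs B).card ≤ A.card * B.card := by
  rw [← Finset.card_product]
  refine le_trans (Finset.card_le_card ?_)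
    (Finset.card_image_le (f := fun a : Fin n × Fin n => s(a.1, a.2)))
  intro e he
  simp only [touchPairs, Finset.mem_inter, Finset.mem_filter, Finset.mem_image,
    Finset.mem_product, Finset.mem_univ, and_true, Prod.exists] at he
  obtain ⟨⟨⟨a, b, ha, rfl⟩, -⟩, ⟨⟨a', b', ha', h'⟩, -⟩⟩ := he
  simp only [Finset.mem_image, Finset.mem_product, Prod.exists]
  rcases Sym2.eq_iff.1 h' with ⟨rfl, rfl⟩ | ⟨rfl, rfl⟩
  · exact absurd ha' (Finset.disjoint_left.1 h ha)
  · exact ⟨_, _, ⟨ha, ha'⟩, rfl⟩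

variable {G : SimpleGraph (Fin n)}

lemma neighborSet_eq_empty_of_edgesIn {A : Finset (Fin n)} (h : edgesIn G (touchPairs A) = 0)
    {i : Fin n} (hi : i ∈ A) : G.neighborSet i = ∅ := by
  classical
  rw [Set.eq_empty_iff_forall_notMem]
  intro j hj
  have hij : G.Adj i j := hj
  rw [edgesIn, Finset.card_eq_zero] at h
  have : s(i, j) ∈ (touchPairs A).filter (· ∈ G.edgeSet) :=
    Finset.mem_filter.2 ⟨mem_touchPairs hi hij.ne, hij⟩
  rw [h] at this
  simp at this

lemma ncard_neighborSet_le_edgesIn (v : Fin n) :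
    (G.neighborSet v).ncard ≤ edgesIn G (touchPairs {v}) := by
  classical
  rw [edgesIn, ← Set.ncard_coe_finset]
  refine Set.ncard_le_ncard_of_injOn (fun j => s(v, j)) (fun j hj => ?_) ?_ (Finset.finite_toSet _)
  · have hj' : G.Adj v j := hj
    exact Finset.mem_coe.2 (Finset.mem_filter.2
      ⟨mem_touchPairs (Finset.mem_singleton_self v) hj'.ne, hj'⟩)
  · intro j _ j' _ h
    exact Sym2.congr_right.1 h

/-- One edge serves at most two nodes. A window without a free node therefore contains or meets many
edges, which is unlikely. -/
lemma card_le_two_mul_edgesIn {A : Finset (Fin n)} (h : ∀ i ∈ A, G.neighborSet i ≠ ∅) :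
    A.card ≤ 2 * edgesIn G (touchPairs A) := by
  classical
  set E := (touchPairs A).filter (· ∈ G.edgeSet)
  have hsub : A ⊆ E.biUnion fun e => e.toFinset := by
    intro i hi
    obtain ⟨j, hj⟩ := Set.nonempty_iff_ne_empty.2 (h i hi)
    have hij : G.Adj i j := hj
    simp only [Finset.mem_biUnion]
    exact ⟨s(i, j), Finset.mem_filter.2 ⟨mem_touchPairs hi hij.ne, hij⟩, by simp⟩
  refine (Finset.card_le_card hsub).trans ?_
  refine (Finset.card_biUnion_le_card_mul E _ 2 fun e he => ?_).trans (by rw [mul_comm]; rfl)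
  rw [Sym2.card_toFinset]
  split_ifs <;> omega

end NodeSets

/-! ### Second moment bound for the absence of edges -/

section SecondMoment

variable {V : Type*} [Fintype V] [DecidableEq V]

omit [Fintype V] in
lemma edgesIn_union_eq_zero (G : SimpleGraph V) (T T' : Finset (Sym2 V)) :
    edgesIn G (T ∪ T') = 0 ↔ edgesIn G T = 0 ∧ edgesIn G T' = 0 := by
  classical
  simp [edgesIn, Finset.filter_union, Finset.union_eq_empty, Finset.card_eq_zero]

lemma integral_ite_edgesIn (p : unitInterval) (T : Finset (Sym2 V))
    (hT : ∀ e ∈ T, ¬ e.IsDiag) :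
    ∫ G, (if edgesIn G T = 0 then (1 : ℝ) else 0) ∂(SimpleGraph.binomialRandom V p) =
      (1 - (p : ℝ)) ^ T.card := by
  have h := integral_pow_edgesIn p T hT 0
  rw [mul_zero, add_zero] at h
  rw [← h]
  congr 1
  ext G
  by_cases hG : edgesIn G T = 0
  · simp [hG]
  · simp [hG]

/-- If the sets `T i` of pairs have small intersections, then with high probability one of them
contains no edge. -/
lemma measureReal_forall_edgesIn_ne_zero_le {ι : Type*} [DecidableEq ι] (p : unitInterval)
    (hp : (p : ℝ) < 1) (s : Finset ι) (hs : s.Nonempty) (T : ι → Finset (Sym2 V))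
    (hT : ∀ i ∈ s, ∀ e ∈ T i, ¬ e.IsDiag) {t D : ℕ} (ht : ∀ i ∈ s, (T i).card ≤ t)
    (hD : ∀ i ∈ s, ∀ j ∈ s, i ≠ j → (T i ∩ T j).card ≤ D) :
    (SimpleGraph.binomialRandom V p).real {G | ∀ i ∈ s, edgesIn G (T i) ≠ 0} ≤
      1 / (s.card * (1 - (p : ℝ)) ^ t) + (1 / (1 - (p : ℝ)) ^ D - 1) := by
  set q : ℝ := 1 - p with hq
  have hq0 : 0 < q := by linarith
  have hq1 : q ≤ 1 := by have := p.2.1; linarith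
  set X : ι → SimpleGraph V → ℝ := fun i G => if edgesIn G (T i) = 0 then 1 else 0 with hX
  set N : SimpleGraph V → ℝ := fun G => ∑ i ∈ s, X i G with hN
  set x : ι → ℝ := fun i => q ^ (T i).card with hx
  set μ : ℝ := ∑ i ∈ s, x i with hμ
  have hμt : s.card * q ^ t ≤ μ := by
    rw [← nsmul_eq_mul, ← Finset.sum_const]
    exact Finset.sum_le_sum fun i hi => pow_le_pow_of_le_one hq0.le hq1 (ht i hi)
  have hpos : 0 < s.card * q ^ t := mul_pos (by exact_mod_cast hs.card_pos) (pow_pos hq0 _)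
  have hμ0 : 0 < μ := hpos.trans_le hμt
  have hEN : ∫ G, N G ∂(SimpleGraph.binomialRandom V p) = μ := by
    simp only [hN]
    rw [integral_finsetSum _ fun i _ => integrable_graph _]
    exact Finset.sum_congr rfl fun i hi => integral_ite_edgesIn p (T i) (hT i hi)
  -- Two events of edge absence are independent up to their common pairs, whose number `D` costs the
  -- factor `1 / q ^ D`.
  have hEXX : ∀ i ∈ s, ∀ j ∈ s, ∫ G, X i G * X j G ∂(SimpleGraph.binomialRandom V p) ≤
      (if i = j then x i else 0) + x i * x j * (1 / q ^ D) := by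
    intro i hi j hj
    have e : ∀ G, X i G * X j G = if edgesIn G (T i ∪ T j) = 0 then (1 : ℝ) else 0 := by
      intro G
      simp only [hX, edgesIn_union_eq_zero]
      split_ifs <;> simp_all
    simp_rw [e]
    rw [integral_ite_edgesIn p _ fun e he => by
      rcases Finset.mem_union.1 he with h | h
      · exact hT i hi e h
      · exact hT j hj e h]
    have hxx : 0 ≤ x i * x j * (1 / q ^ D) := by positivity
    by_cases hij : i = j
    · subst hij
      simp only [Finset.union_self, if_true]
      change x i ≤ _
      linarith
    · rw [if_neg hij, zero_add, mul_one_div, le_div_iff₀ (pow_pos hq0 _)]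
      calc q ^ (T i ∪ T j).card * q ^ D
          ≤ q ^ (T i ∪ T j).card * q ^ (T i ∩ T j).card := by
            refine mul_le_mul_of_nonneg_left ?_ (by positivity)
            exact pow_le_pow_of_le_one hq0.le hq1 (hD i hi j hj hij)
        _ = x i * x j := by
            simp only [hx]
            rw [← pow_add, Finset.card_union_add_card_inter, pow_add]
  have hEN2 : ∫ G, N G ^ 2 ∂(SimpleGraph.binomialRandom V p) ≤ μ + μ ^ 2 * (1 / q ^ D) := by
    have e : ∀ G, N G ^ 2 = ∑ i ∈ s, ∑ j ∈ s, X i G * X j G := fun G => by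
      rw [sq, hN, Finset.sum_mul_sum]
    simp_rw [e]
    rw [integral_finsetSum _ fun i _ => integrable_graph _]
    have e2 : ∀ i ∈ s, ∫ G, ∑ j ∈ s, X i G * X j G ∂(SimpleGraph.binomialRandom V p) =
        ∑ j ∈ s, ∫ G, X i G * X j G ∂(SimpleGraph.binomialRandom V p) := fun i _ =>
      integral_finsetSum _ fun j _ => integrable_graph _
    rw [Finset.sum_congr rfl e2]
    refine (Finset.sum_le_sum fun i hi => Finset.sum_le_sum fun j hj =>
      hEXX i hi j hj).trans (le_of_eq ?_)
    simp_rw [Finset.sum_add_distrib, ← Finset.sum_mul, ← Finset.sum_mul_sum]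
    rw [← hμ, ← sq]
    congr 1
    refine Finset.sum_congr rfl fun i hi => ?_
    rw [Finset.sum_ite_eq, if_pos hi]
  -- Chebyshev's inequality: on the bad event `N = 0`, so `(1 - N / μ) ^ 2` equals `1`.
  have hb := measureReal_le_integral (p := p) {G : SimpleGraph V | ∀ i ∈ s, edgesIn G (T i) ≠ 0}
    (fun G => (1 - N G / μ) ^ 2) (fun G => sq_nonneg _) (fun G hG => by
      have : N G = 0 := Finset.sum_eq_zero fun i hi => by
        simp only [hX]; rw [if_neg (hG i hi)]
      simp [this])
  have hexp : ∫ G, (1 - N G / μ) ^ 2 ∂(SimpleGraph.binomialRandom V p) =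
      1 - 2 / μ * ∫ G, N G ∂(SimpleGraph.binomialRandom V p) +
        1 / μ ^ 2 * ∫ G, N G ^ 2 ∂(SimpleGraph.binomialRandom V p) := by
    have e : ∀ G, (1 - N G / μ) ^ 2 = 1 - 2 / μ * N G + 1 / μ ^ 2 * N G ^ 2 := fun G => by
      field_simp; ring
    simp_rw [e]
    rw [integral_add (integrable_graph _) (integrable_graph _),
      integral_sub (integrable_graph _) (integrable_graph _),
      integral_const_mul, integral_const_mul]
    simp
  rw [hexp, hEN] at hb
  have h1 : 1 / μ ^ 2 * ∫ G, N G ^ 2 ∂(SimpleGraph.binomialRandom V p) ≤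
      1 / μ ^ 2 * (μ + μ ^ 2 * (1 / q ^ D)) := mul_le_mul_of_nonneg_left hEN2 (by positivity)
  have h2 : 1 / μ ^ 2 * (μ + μ ^ 2 * (1 / q ^ D)) = 1 / μ + 1 / q ^ D := by
    field_simp
  have h3 : 2 / μ * μ = 2 := by field_simp
  have h4 : 1 / μ ≤ 1 / (s.card * q ^ t) := one_div_le_one_div_of_le hpos hμt
  linarith

end SecondMoment

/-! ### Asymptotic properties of the long range edges -/

section Asymptotic

/-- The probability of a long range edge. -/
def edgeProb (α : ℝ) (n : ℕ) : unitInterval :=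
  Set.projIcc (0 : ℝ) 1 zero_le_one (2 * (n : ℝ) ^ (-α))

lemma edgeProb_eq {α : ℝ} (hα : 1 < α) {n : ℕ} (hn : 2 ≤ n) :
    (edgeProb α n : ℝ) = 2 * (n : ℝ) ^ (-α) := by
  have hn' : (2 : ℝ) ≤ n := by exact_mod_cast hn
  have h1 : (n : ℝ) ^ (-α) ≤ (n : ℝ) ^ (-1 : ℝ) :=
    Real.rpow_le_rpow_of_exponent_le (by linarith) (by linarith)
  rw [Real.rpow_neg_one] at h1
  have h2 : (n : ℝ)⁻¹ ≤ 2⁻¹ := by gcongr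
  unfold edgeProb
  rw [Set.projIcc_of_mem zero_le_one
    ⟨by positivity, by linarith⟩]

lemma longRangeLaw_eq (α : ℝ) (n : ℕ) :
    longRangeLaw α n = SimpleGraph.binomialRandom (Fin n) (edgeProb α n) := rfl

lemma aas_of_forall {α : ℝ} {ι : ℕ → Type*} [∀ n, Fintype (ι n)]
    {E : ∀ n, ι n → SimpleGraph (Fin n) → Prop} {b : ℕ → ℝ} (hb : Tendsto b atTop (𝓝 0))
    (h : ∀ᶠ n in atTop, ∑ i, (longRangeLaw α n).real {G | ¬ E n i G} ≤ b n) :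
    AAS α fun n G => ∀ i, E n i G := by
  refine AAS.of_le hb ?_
  filter_upwards [h] with n hn
  refine le_trans ?_ hn
  refine le_trans (measureReal_mono ?_ (measure_ne_top _ _))
    (measureReal_biUnion_finset_le Finset.univ fun i => {G | ¬ E n i G})
  intro G hG
  simpa using hG

/-- A fixed number of nodes meets `m` long range edges with probability of order `n ^ ((1 - α) * m)`
at most. Beating the union bound over `n` positions is what fixes `m`. -/
lemma tendsto_card_mul_pow {α : ℝ} {C : ℝ} {m : ℕ} (hm : 1 < (α - 1) * m) :
    Tendsto (fun n : ℕ => (n : ℝ) * (Real.exp 1 * (C * (n : ℝ) ^ (1 - α)) ^ m)) atTop (𝓝 0) := by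
  have h1 : Tendsto (fun n : ℕ => (Real.exp 1 * C ^ m) * (n : ℝ) ^ (-((α - 1) * m - 1)))
      atTop (𝓝 ((Real.exp 1 * C ^ m) * 0)) :=
    ((tendsto_rpow_neg_atTop (by linarith)).comp tendsto_natCast_atTop_atTop).const_mul _
  rw [mul_zero] at h1
  refine h1.congr' ?_
  filter_upwards [eventually_gt_atTop 0] with n hn
  have hn' : (0 : ℝ) < n := by exact_mod_cast hn
  rw [mul_pow, ← Real.rpow_natCast ((n : ℝ) ^ (1 - α)) m, ← Real.rpow_mul hn'.le]
  have : -((α - 1) * m - 1) = 1 + (1 - α) * m := by ring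
  rw [this, Real.rpow_add hn', Real.rpow_one]
  ring

lemma measureReal_le_edgesIn_touchPairs {α : ℝ} (hα : 1 < α) {n : ℕ} (hn : 2 ≤ n)
    (A : Finset (Fin n)) {l : ℕ} (hl : 0 < l) (hA : A.card ≤ l) (m : ℕ) :
    (longRangeLaw α n).real {G | m ≤ edgesIn G (touchPairs A)} ≤
      Real.exp 1 * (2 * l * (n : ℝ) ^ (1 - α)) ^ m := by
  have hn' : (0 : ℝ) < n := by positivity
  rw [longRangeLaw_eq]
  refine measureReal_le_edgesIn _ _ (touchPairs_not_isDiag A) (by positivity) ?_ m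
  rw [edgeProb_eq hα hn]
  have h1 : ((touchPairs A).card : ℝ) ≤ l * n := by
    exact_mod_cast (card_touchPairs_le A).trans (Nat.mul_le_mul_right n hA)
  calc 2 * (n : ℝ) ^ (-α) * (touchPairs A).card ≤ 2 * (n : ℝ) ^ (-α) * (l * n) := by gcongr
    _ = 2 * l * (n : ℝ) ^ (1 - α) := by
      rw [show (1 - α) = -α + 1 by ring, Real.rpow_add hn', Real.rpow_one]; ring

lemma exists_isDegreeBound {α : ℝ} (hα : 1 < α) : ∃ d : ℝ, IsDegreeBound α d := by
  obtain ⟨m, hm⟩ := exists_nat_gt (1 / (α - 1))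
  have hm' : 1 < (α - 1) * m := by
    rw [div_lt_iff₀ (by linarith)] at hm; linarith
  refine ⟨m, aas_of_forall (tendsto_card_mul_pow (C := 2 * (1 : ℕ)) hm') ?_⟩
  filter_upwards [eventually_ge_atTop 2] with n hn
  have h : ∀ v : Fin n, (longRangeLaw α n).real
      {G | ¬ ((G.neighborSet v).ncard : ℝ) ≤ m} ≤
      Real.exp 1 * (2 * (1 : ℕ) * (n : ℝ) ^ (1 - α)) ^ m := by
    intro v
    refine (measureReal_mono fun G hG => ?_).trans
      (measureReal_le_edgesIn_touchPairs hα hn {v} one_pos (by simp) m)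
    have : m < (G.neighborSet v).ncard := by
      have h := not_le.1 hG
      exact_mod_cast h
    exact this.le.trans (ncard_neighborSet_le_edgesIn v)
  refine (Finset.sum_le_sum fun v _ => h v).trans (le_of_eq ?_)
  simp

/-- A.a.s. there is a node without long range edges in every window of some fixed length. -/
lemma exists_aas_window {α : ℝ} (hα : 1 < α) : ∃ l : ℕ, AAS α fun n G =>
    ∀ i : Fin n, ∃ k < l, G.neighborSet ((finRotate n ^ k) i) = ∅ := by
  obtain ⟨m, hm⟩ := exists_nat_gt (1 / (α - 1))
  have hm0 : 0 < m := by
    have : (0 : ℝ) < m := lt_trans (by have : 0 < α - 1 := by linarith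
                                       positivity) hm
    exact_mod_cast this
  have hm' : 1 < (α - 1) * m := by
    rw [div_lt_iff₀ (by linarith)] at hm; linarith
  -- A window of `2 m` distinct nodes, none of them free, would meet at least `m` edges.
  -- Distinctness requires that `n` exceeds the window length.
  refine ⟨2 * m, aas_of_forall (tendsto_card_mul_pow (C := 2 * (2 * m : ℕ)) hm') ?_⟩
  filter_upwards [eventually_ge_atTop (2 * m + 2)] with n hn
  have h : ∀ v : Fin n, (longRangeLaw α n).real
      {G | ¬ ∃ k < 2 * m, G.neighborSet ((finRotate n ^ k) v) = ∅} ≤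
      Real.exp 1 * (2 * (2 * m : ℕ) * (n : ℝ) ^ (1 - α)) ^ m := by
    intro v
    set A : Finset (Fin n) := (Finset.range (2 * m)).image fun k => (finRotate n ^ k) v with hA
    have hcard : A.card = 2 * m := by
      rw [hA, Finset.card_image_of_injOn, Finset.card_range]
      obtain ⟨N, rfl⟩ : ∃ N, n = N + 1 := ⟨n - 1, by omega⟩
      have hpow : ∀ k : ℕ, (((finRotate (N + 1) ^ k) v : Fin (N + 1)) : ℕ) = (v + k) % (N + 1) := by
        intro k
        induction k with
        | zero => simp [Nat.mod_eq_of_lt v.2]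
        | succ k ih =>
          rw [pow_succ', Equiv.Perm.mul_apply, finRotate_apply, Fin.val_add, ih, Fin.val_one',
            ← Nat.add_mod, add_assoc]
      intro k hk k' hk' hkk
      simp only [Finset.coe_range, Set.mem_Iio] at hk hk'
      have h1 := congrArg Fin.val hkk
      simp only [hpow] at h1
      have h2 : k ≡ k' [MOD (N + 1)] := Nat.ModEq.add_left_cancel' (v : ℕ) h1
      exact h2.eq_of_lt_of_lt (by omega) (by omega)
    refine (measureReal_mono fun G hG => ?_).trans
      (measureReal_le_edgesIn_touchPairs hα (by omega) A (by omega) hcard.le m)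
    have hG' : ∀ i ∈ A, G.neighborSet i ≠ ∅ := by
      intro i hi h0
      obtain ⟨k, hk, rfl⟩ := Finset.mem_image.1 hi
      exact hG ⟨k, Finset.mem_range.1 hk, h0⟩
    have := card_le_two_mul_edgesIn hG'
    show m ≤ edgesIn G (touchPairs A)
    omega
  refine (Finset.sum_le_sum fun v _ => h v).trans (le_of_eq ?_)
  simp

/-- A.a.s. every set of at most half of the nodes has many boundary edges, either of the cycle or
of the long range graph. -/
lemma aas_isoperimetry {α : ℝ} (hα : 1 < α) : AAS α fun n G =>
    ∀ S : Finset (Fin n), 2 * S.card ≤ n →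
      (S.card : ℝ) ≤ 8 * ((n : ℝ) ^ (α - 1) * Real.log n) * (cycleBoundary S).card ∨
      (S.card : ℝ) * (n : ℝ) ^ (1 - α) / 4 ≤ edgesIn G (cutPairs S) := by
  have hb : Tendsto (fun n : ℕ => 2 * (Real.exp (1 / (n : ℝ)) - 1)) atTop (𝓝 0) := by
    have h1 : Tendsto (fun n : ℕ => 1 / (n : ℝ)) atTop (𝓝 0) :=
      tendsto_const_div_atTop_nhds_zero_nat 1
    have h2 := ((Real.continuous_exp.tendsto 0).comp h1).sub_const 1 |>.const_mul 2
    simpa using h2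
  refine aas_of_forall hb ?_
  filter_upwards [eventually_ge_atTop 2] with n hn
  have hn' : (0 : ℝ) < n := by positivity
  have hx : (0 : ℝ) ≤ 1 / (n : ℝ) ^ 2 := by positivity
  have hlog : 0 ≤ Real.log n := Real.log_natCast_nonneg n
  have h : ∀ S : Finset (Fin n), (longRangeLaw α n).real
      {G | ¬ (2 * S.card ≤ n →
      (S.card : ℝ) ≤ 8 * ((n : ℝ) ^ (α - 1) * Real.log n) * (cycleBoundary S).card ∨
      (S.card : ℝ) * (n : ℝ) ^ (1 - α) / 4 ≤ edgesIn G (cutPairs S))} ≤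
      if (cycleBoundary S).Nonempty then (1 / (n : ℝ) ^ 2) ^ (cycleBoundary S).card else 0 := by
    intro S
    by_cases hS : 2 * S.card ≤ n ∧
        8 * ((n : ℝ) ^ (α - 1) * Real.log n) * (cycleBoundary S).card < S.card
    · obtain ⟨hS1, hS2⟩ := hS
      have hne : S.Nonempty := by
        rw [Finset.nonempty_iff_ne_empty]
        rintro rfl
        simp only [Finset.card_empty, Nat.cast_zero] at hS2
        have : 0 ≤ 8 * ((n : ℝ) ^ (α - 1) * Real.log n) * (cycleBoundary (∅ : Finset (Fin n))).card := by
          positivity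
        linarith
      rw [if_pos (cycleBoundary_nonempty hne hS1)]
      -- At least half of the nodes lie outside `S`, so the mean number of edges in the cut is at
      -- least `|S| * n ^ (1 - α)`.
      have hpc : (S.card : ℝ) * (n : ℝ) ^ (1 - α) / 4 ≤
          edgeProb α n * (cutPairs S).card / 4 := by
        rw [edgeProb_eq hα hn, card_cutPairs, Finset.card_compl, Fintype.card_fin]
        have h1 : (n : ℝ) / 2 ≤ ((n - S.card : ℕ) : ℝ) := by
          rw [Nat.cast_sub (by omega)]
          have : 2 * (S.card : ℝ) ≤ n := by exact_mod_cast hS1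
          linarith
        have h2 : (n : ℝ) ^ (1 - α) = (n : ℝ) ^ (-α) * n := by
          rw [show (1 - α) = -α + 1 by ring, Real.rpow_add hn', Real.rpow_one]
        rw [h2]
        push_cast
        have h3 : 0 ≤ (n : ℝ) ^ (-α) * S.card := by positivity
        nlinarith [mul_le_mul_of_nonneg_left h1 h3]
      refine (measureReal_mono (s₂ := {G | (edgesIn G (cutPairs S) : ℝ) <
        edgeProb α n * (cutPairs S).card / 4}) fun G hG => ?_).trans
        ((measureReal_edgesIn_lt (edgeProb α n) _ (cutPairs_not_isDiag S)).trans ?_)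
      · simp only [Set.mem_ofPred_eq, Classical.not_imp, not_or, not_le] at hG ⊢
        linarith [hG.2.2]
      -- The constant `8` is `4 * 2`: the Chernoff exponent is a quarter of the mean, and an
      -- exponent of `2 log n` per boundary edge makes the sum over all boundaries vanish.
      · have h4 : 2 * (cycleBoundary S).card * Real.log n ≤
            (S.card : ℝ) * (n : ℝ) ^ (1 - α) / 4 := by
          have h5 : (n : ℝ) ^ (α - 1) * (n : ℝ) ^ (1 - α) = 1 := by
            rw [← Real.rpow_add hn']; simp
          have h6 := mul_le_mul_of_nonneg_right hS2.le
            (by positivity : 0 ≤ (n : ℝ) ^ (1 - α))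
          have h7 : 8 * ((n : ℝ) ^ (α - 1) * Real.log n) * (cycleBoundary S).card *
              (n : ℝ) ^ (1 - α) = 8 * Real.log n * (cycleBoundary S).card *
              ((n : ℝ) ^ (α - 1) * (n : ℝ) ^ (1 - α)) := by ring
          rw [h7, h5] at h6
          linarith
        calc Real.exp (-(edgeProb α n * (cutPairs S).card / 4))
            ≤ Real.exp (-(2 * (cycleBoundary S).card * Real.log n)) := by
              apply Real.exp_le_exp.2; linarith
          _ = (1 / (n : ℝ) ^ 2) ^ (cycleBoundary S).card := by
              rw [Real.exp_neg, show 2 * ((cycleBoundary S).card : ℝ) * Real.log n =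
                ((2 * (cycleBoundary S).card : ℕ) : ℝ) * Real.log n by push_cast; ring,
                Real.exp_nat_mul, Real.exp_log hn', one_div, inv_pow, pow_mul]
    · have : {G | ¬ (2 * S.card ≤ n →
          (S.card : ℝ) ≤ 8 * ((n : ℝ) ^ (α - 1) * Real.log n) * (cycleBoundary S).card ∨
          (S.card : ℝ) * (n : ℝ) ^ (1 - α) / 4 ≤ edgesIn G (cutPairs S))} = ∅ := by
        rw [Set.eq_empty_iff_forall_notMem]
        intro G hG
        simp only [Set.mem_ofPred_eq, Classical.not_imp, not_or, not_le] at hG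
        exact hS ⟨hG.1, hG.2.1⟩
      rw [this, measureReal_empty]
      split_ifs
      · positivity
      · rfl
  refine (Finset.sum_le_sum fun S _ => h S).trans ?_
  rw [← Finset.sum_filter]
  refine (sum_pow_cycleBoundary_le (by omega) hx).trans ?_
  have h8 : (1 + 1 / (n : ℝ) ^ 2) ^ n ≤ Real.exp (1 / n) := by
    have h9 := Real.add_one_le_exp (1 / (n : ℝ) ^ 2)
    calc (1 + 1 / (n : ℝ) ^ 2) ^ n ≤ (Real.exp (1 / (n : ℝ) ^ 2)) ^ n := by
          gcongr; linarith
      _ = Real.exp (1 / n) := by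
          rw [← Real.exp_nat_mul]; congr 1; field_simp
  linarith

/-- A bound below `1` would a.a.s. forbid all long range edges. But the mean number of edges between
two halves of the cycle is of order `n ^ (2 - α)`, which tends to infinity. -/
lemma one_le_of_isDegreeBound {α d : ℝ} (hα : 1 < α) (hα2 : α < 2) (hd : IsDegreeBound α d) :
    1 ≤ d := by
  by_contra! hlt
  set S : ∀ n : ℕ, Finset (Fin n) := fun n => Finset.univ.filter fun i => 2 * (i : ℕ) < n - 1
  have hS : ∀ n : ℕ, (S n).card = n / 2 := by
    intro n
    have : (S n).map Fin.valEmbedding = Finset.range (n / 2) := by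
      ext i
      simp only [S, Finset.mem_map, Finset.mem_filter, Finset.mem_univ, true_and,
        Fin.valEmbedding_apply, Finset.mem_range]
      constructor
      · rintro ⟨a, ha, rfl⟩; omega
      · intro hi; exact ⟨⟨i, by omega⟩, by simp only; omega, rfl⟩
    rw [← Finset.card_map Fin.valEmbedding, this, Finset.card_range]
  have hb : Tendsto (fun n : ℕ => Real.exp (-((n : ℝ) ^ (2 - α) / 6))) atTop (𝓝 0) := by
    refine Real.tendsto_exp_neg_atTop_nhds_zero.comp ?_
    refine Tendsto.atTop_div_const (by norm_num) ?_
    exact (tendsto_rpow_atTop (by linarith)).comp tendsto_natCast_atTop_atTop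
  have hE : AAS α fun n G => edgesIn G (cutPairs (S n)) ≠ 0 := by
    refine AAS.of_le hb ?_
    filter_upwards [eventually_ge_atTop 2] with n hn
    have hn' : (0 : ℝ) < n := by positivity
    simp only [ne_eq, not_not]
    rw [longRangeLaw_eq, measureReal_edgesIn_eq_zero _ _ (cutPairs_not_isDiag _)]
    have h1 := Real.add_one_le_exp (-(edgeProb α n : ℝ))
    have h2 := (edgeProb α n).2.2
    calc (1 - (edgeProb α n : ℝ)) ^ (cutPairs (S n)).card
        ≤ (Real.exp (-(edgeProb α n : ℝ))) ^ (cutPairs (S n)).card := by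
          gcongr
          linarith
      _ = Real.exp (-((cutPairs (S n)).card * edgeProb α n)) := by
          rw [← Real.exp_nat_mul]; congr 1; ring
      _ ≤ Real.exp (-((n : ℝ) ^ (2 - α) / 6)) := by
          apply Real.exp_le_exp.2
          apply neg_le_neg
          rw [edgeProb_eq hα hn, card_cutPairs, Finset.card_compl, Fintype.card_fin, hS]
          have h3 : n ≤ 3 * (n / 2) := by omega
          have h4 : n ≤ 2 * (n - n / 2) := by omega
          have h3' : (n : ℝ) ≤ 3 * ((n / 2 : ℕ) : ℝ) := by exact_mod_cast h3
          have h4' : (n : ℝ) ≤ 2 * ((n - n / 2 : ℕ) : ℝ) := by exact_mod_cast h4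
          have h5 : (n : ℝ) ^ (2 - α) = (n : ℝ) ^ (-α) * (n * n) := by
            rw [show (2 - α) = -α + 1 + 1 by ring, Real.rpow_add hn', Real.rpow_add hn',
              Real.rpow_one]; ring
          rw [h5, Nat.cast_mul]
          have h6 : (n : ℝ) * n ≤ (3 * ((n / 2 : ℕ) : ℝ)) * (2 * ((n - n / 2 : ℕ) : ℝ)) :=
            mul_le_mul h3' h4' hn'.le (by positivity)
          have h7 := mul_le_mul_of_nonneg_left h6 (by positivity : 0 ≤ (n : ℝ) ^ (-α))
          have h8 : 0 ≤ (n : ℝ) ^ (-α) * (n * n) := by positivity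
          linarith
  obtain ⟨n, G, h1, h2⟩ := (hE.and hd).exists
  apply h1
  classical
  rw [edgesIn, Finset.card_eq_zero, Finset.filter_eq_empty_iff]
  intro e he
  induction e using Sym2.ind with
  | _ a b =>
    intro hab
    have hab' : b ∈ G.neighborSet a := hab
    have h3 : 0 < (G.neighborSet a).ncard := (Set.ncard_pos (Set.toFinite _)).2 ⟨b, hab'⟩
    have h4 : (1 : ℝ) ≤ (G.neighborSet a).ncard := by exact_mod_cast h3
    linarith [h2 a]

lemma tendsto_log_div_rpow {β : ℝ} (hβ : 0 < β) :
    Tendsto (fun n : ℕ => Real.log n / (n : ℝ) ^ β) atTop (𝓝 0) :=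
  ((isLittleO_log_rpow_atTop hβ).tendsto_div_nhds_zero).comp tendsto_natCast_atTop_atTop

lemma tendsto_rpow_mul_log {β : ℝ} (hβ : 0 < β) :
    Tendsto (fun n : ℕ => (n : ℝ) ^ β * Real.log n) atTop atTop :=
  ((tendsto_rpow_atTop hβ).comp tendsto_natCast_atTop_atTop).atTop_mul_atTop₀
    (Real.tendsto_log_atTop.comp tendsto_natCast_atTop_atTop)

lemma exp_neg_le_one_sub_pow {p : ℝ} (hp0 : 0 ≤ p) (hp : p ≤ 1 / 2) (t : ℕ) :
    Real.exp (-(2 * (p * t))) ≤ (1 - p) ^ t := by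
  have h : Real.exp (-(2 * p)) ≤ 1 - p := by
    rw [Real.exp_neg, inv_le_comm₀ (Real.exp_pos _) (by linarith)]
    refine le_trans ?_ (Real.add_one_le_exp _)
    rw [inv_le_iff_one_le_mul₀ (by linarith)]
    nlinarith
  calc Real.exp (-(2 * (p * t))) = Real.exp (-(2 * p)) ^ t := by
        rw [← Real.exp_nat_mul]; congr 1; ring
    _ ≤ (1 - p) ^ t := by gcongr

/-- A.a.s. some arc of length of order `n ^ (α - 1) * log n` has no long range edges. -/
lemma exists_aas_free_arc {α : ℝ} (hα : 1 < α) (hα2 : α < 2) : ∃ c : ℝ, 0 < c ∧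
    AAS α fun n G => ∃ a L : ℕ, a + L ≤ n ∧ c * ((n : ℝ) ^ (α - 1) * Real.log n) ≤ L ∧
      (L : ℝ) ≤ (n : ℝ) ^ (α - 1) * Real.log n ∧
      ∀ i : Fin n, a ≤ i → (i : ℕ) < a + L → G.neighborSet i = ∅ := by
  -- With this `c`, a given arc is free with probability at least `n ^ (-(2 - α) / 2) = 1 / y`.
  -- There are at least `y / w n` disjoint arcs, so the mean number of free ones is at least `1 / w
  -- n`, which tends to infinity.
  set c : ℝ := (2 - α) / 16 with hc
  have hc0 : 0 < c := by rw [hc]; linarith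
  have hc1 : c ≤ 1 / 16 := by rw [hc]; linarith
  refine ⟨c, hc0, ?_⟩
  set w : ℕ → ℝ := fun n => Real.log n / (n : ℝ) ^ ((2 - α) / 2) with hw
  have hw0 : Tendsto w atTop (𝓝 0) := tendsto_log_div_rpow (by linarith)
  have hb : Tendsto (fun n => w n + (Real.exp (4 * w n ^ 2) - 1)) atTop (𝓝 0) := by
    have h1 : Tendsto (fun n => 4 * w n ^ 2) atTop (𝓝 0) := by
      simpa using (hw0.pow 2).const_mul 4
    have h2 := (Real.continuous_exp.tendsto 0).comp h1
    simpa using hw0.add (h2.sub_const 1)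
  have hΛ := tendsto_rpow_mul_log (β := α - 1) (by linarith)
  refine AAS.of_le hb ?_
  filter_upwards [eventually_ge_atTop 4, hΛ.eventually_ge_atTop (1 / c),
    hw0.eventually_le_const zero_lt_one] with n hn hΛn hw1
  have hn1 : (1 : ℝ) < n := by exact_mod_cast (by omega : 1 < n)
  have hn' : (0 : ℝ) < n := by linarith
  have hlog : 0 < Real.log n := Real.log_pos hn1
  set Λ : ℝ := (n : ℝ) ^ (α - 1) * Real.log n with hΛdef
  have hΛpos : 0 < Λ := by positivity
  have hcΛ : 1 ≤ c * Λ := by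
    rw [div_le_iff₀ hc0] at hΛn; linarith
  set L : ℕ := ⌈c * Λ⌉₊ with hL
  have hL1 : c * Λ ≤ L := Nat.le_ceil _
  have hL2 : (L : ℝ) ≤ 2 * c * Λ := by
    have := Nat.ceil_lt_add_one (by positivity : 0 ≤ c * Λ)
    linarith
  have hL3 : (L : ℝ) ≤ Λ := by nlinarith
  have hL0 : 0 < L := by
    have : (0 : ℝ) < L := by linarith
    exact_mod_cast this
  set y : ℝ := (n : ℝ) ^ ((2 - α) / 2) with hy
  have hy0 : 0 < y := by positivity
  have hy1 : 1 ≤ y := Real.one_le_rpow hn1.le (by linarith)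
  have hlogw : Real.log n = w n * y := by simp only [hw]; rw [div_mul_cancel₀ _ hy0.ne']
  have hny : (n : ℝ) ^ (α - 1) * (y * y) = n := by
    rw [hy, ← Real.rpow_add hn', ← Real.rpow_add hn',
      show α - 1 + ((2 - α) / 2 + (2 - α) / 2) = 1 by ring, Real.rpow_one]
  have hwpos : 0 < w n := by simp only [hw]; positivity
  have hΛn' : Λ ≤ n := by
    rw [← hny, hΛdef, hlogw]
    have : w n * y ≤ y * y := by nlinarith
    gcongr
  have hLn : L ≤ n := by exact_mod_cast hL3.trans hΛn'
  set M : ℕ := n / L with hM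
  have hM0 : 0 < M := Nat.div_pos hLn hL0
  have hM1 : (n : ℝ) ≤ 2 * L * M := by
    have h1 : n < L * M + L := Nat.lt_mul_div_succ n hL0
    have h2 : L * 1 ≤ L * M := Nat.mul_le_mul_left L hM0
    have h3 : n ≤ 2 * L * M := by nlinarith
    exact_mod_cast h3
  have hp := edgeProb_eq hα (n := n) (by omega)
  have hp0 := (edgeProb α n).2.1
  have hp12 : (edgeProb α n : ℝ) ≤ 1 / 2 := by
    have h1 : (n : ℝ) ^ (-α) ≤ (n : ℝ) ^ (-1 : ℝ) :=
      Real.rpow_le_rpow_of_exponent_le hn1.le (by linarith)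
    rw [Real.rpow_neg_one] at h1
    have h2 : (n : ℝ)⁻¹ ≤ 4⁻¹ := by
      have : (4 : ℝ) ≤ n := by exact_mod_cast hn
      gcongr
    rw [hp]; linarith
  set A : ℕ → Finset (Fin n) := fun i => Finset.univ.filter fun v => (v : ℕ) / L = i with hA
  have hAmem : ∀ (i : ℕ) (v : Fin n), i * L ≤ v → (v : ℕ) < i * L + L → v ∈ A i := by
    intro i v h1 h2
    simp only [hA, Finset.mem_filter, Finset.mem_univ, true_and]
    rw [Nat.div_eq_iff hL0]
    omega
  have hAcard : ∀ i, (A i).card ≤ L := by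
    intro i
    have := Finset.card_le_card_of_injOn (s := A i) (t := Finset.Ico (i * L) (i * L + L))
      (fun v => (v : ℕ)) (fun v hv => by
        have hv' : (v : ℕ) / L = i := by simpa [hA] using hv
        rw [Nat.div_eq_iff hL0] at hv'
        simp only [Finset.coe_Ico, Set.mem_Ico]
        omega) (fun i _ j _ hij => Fin.ext hij)
    simpa using this
  have hmain := measureReal_forall_edgesIn_ne_zero_le (edgeProb α n) (by linarith)
    (Finset.range M) ⟨0, Finset.mem_range.2 hM0⟩ (fun i => touchPairs (A i))
    (fun i _ => touchPairs_not_isDiag _) (t := L * n) (D := L * L)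
    (fun i _ => (card_touchPairs_le _).trans (Nat.mul_le_mul_right n (hAcard i)))
    (fun i _ j _ hij => by
      refine (card_touchPairs_inter_le ?_).trans (Nat.mul_le_mul (hAcard i) (hAcard j))
      rw [Finset.disjoint_left]
      intro v hv hv'
      simp only [hA, Finset.mem_filter, Finset.mem_univ, true_and] at hv hv'
      exact hij (hv.symm.trans hv'))
  refine (measureReal_mono ?_).trans (hmain.trans ?_)
  · intro G hG i hi h0
    have hiM : i + 1 ≤ M := Finset.mem_range.1 hi
    refine hG ⟨i * L, L, ?_, hL1, hL3, fun v h1 h2 =>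
      neighborSet_eq_empty_of_edgesIn h0 (hAmem i v h1 h2)⟩
    calc i * L + L = (i + 1) * L := by ring
      _ ≤ M * L := Nat.mul_le_mul_right L hiM
      _ ≤ n := Nat.div_mul_le_self n L
  · rw [Finset.card_range]
    have hqt := exp_neg_le_one_sub_pow hp0 hp12 (L * n)
    have hqD := exp_neg_le_one_sub_pow hp0 hp12 (L * L)
    have hpow1 : (n : ℝ) ^ (-α) * n * (n : ℝ) ^ (α - 1) = 1 := by
      nth_rewrite 2 [← Real.rpow_one (n : ℝ)]
      rw [← Real.rpow_add hn', ← Real.rpow_add hn', show -α + 1 + (α - 1) = 0 by ring,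
        Real.rpow_zero]
    have hnα : 0 < (n : ℝ) ^ (-α) := by positivity
    refine add_le_add ?_ (sub_le_sub_right ?_ 1)
    · have h1 : 1 / y ≤ (1 - (edgeProb α n : ℝ)) ^ (L * n) := by
        refine le_trans ?_ hqt
        have e : 1 / y = Real.exp (-((2 - α) / 2 * Real.log n)) := by
          rw [Real.exp_neg, hy, Real.rpow_def_of_pos hn', mul_comm (Real.log n), one_div]
        rw [e]
        apply Real.exp_le_exp.2
        apply neg_le_neg
        rw [hp]
        push_cast
        calc 2 * (2 * (n : ℝ) ^ (-α) * (L * n)) ≤ 2 * (2 * (n : ℝ) ^ (-α) * (2 * c * Λ * n)) := by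
              gcongr
          _ = 8 * c * Real.log n * ((n : ℝ) ^ (-α) * n * (n : ℝ) ^ (α - 1)) := by
              rw [hΛdef]; ring
          _ = (2 - α) / 2 * Real.log n := by rw [hpow1, hc]; ring
      have h2 : y / w n ≤ M := by
        rw [div_le_iff₀ hwpos]
        have h3 : (n : ℝ) ≤ Λ * M := by
          have h4 : 2 * (L : ℝ) ≤ Λ := by nlinarith
          have h5 : (0 : ℝ) ≤ M := Nat.cast_nonneg M
          nlinarith
        rw [← hny, hΛdef, hlogw] at h3
        have h6 : (n : ℝ) ^ (α - 1) * y * y ≤ (n : ℝ) ^ (α - 1) * y * (M * w n) := by linarith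
        exact le_of_mul_le_mul_left h6 (by positivity)
      have h7 : 1 / w n ≤ M * (1 - (edgeProb α n : ℝ)) ^ (L * n) := by
        calc 1 / w n = y / w n * (1 / y) := by field_simp
          _ ≤ M * (1 - (edgeProb α n : ℝ)) ^ (L * n) := by gcongr
      calc 1 / (M * (1 - (edgeProb α n : ℝ)) ^ (L * n)) ≤ 1 / (1 / w n) :=
            one_div_le_one_div_of_le (by positivity) h7
        _ = w n := one_div_one_div _
    -- Disjoint arcs share at most `L ^ 2` pairs, whose mean number of edges is at most `2 * w n ^
    -- 2`. The correlations are thus negligible.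
    · have h1 : Real.exp (-(4 * w n ^ 2)) ≤ (1 - (edgeProb α n : ℝ)) ^ (L * L) := by
        refine le_trans ?_ hqD
        apply Real.exp_le_exp.2
        apply neg_le_neg
        rw [hp]
        push_cast
        have h2 : (n : ℝ) ^ (-α) * (Λ * Λ) = w n ^ 2 := by
          have h3 : Λ = (n : ℝ) ^ (α - 1) * (w n * y) := by rw [hΛdef, ← hlogw]
          calc (n : ℝ) ^ (-α) * (Λ * Λ) = w n ^ 2 * ((n : ℝ) ^ (-α) *
                ((n : ℝ) ^ (α - 1) * (y * y)) * (n : ℝ) ^ (α - 1)) := by rw [h3]; ring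
            _ = w n ^ 2 := by rw [hny, hpow1, mul_one]
        rw [← h2]
        calc 2 * (2 * (n : ℝ) ^ (-α) * (L * L)) ≤ 2 * (2 * (n : ℝ) ^ (-α) * (Λ * Λ)) := by
              gcongr
          _ = 4 * ((n : ℝ) ^ (-α) * (Λ * Λ)) := by ring
      calc 1 / (1 - (edgeProb α n : ℝ)) ^ (L * L) ≤ 1 / Real.exp (-(4 * w n ^ 2)) :=
            one_div_le_one_div_of_le (Real.exp_pos _) h1
        _ = Real.exp (4 * w n ^ 2) := by rw [Real.exp_neg, one_div, inv_inv]

end Asymptotic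

/-! ### The mixing time of the homogeneous chain -/

section MixingTime

variable {n : ℕ} {G : SimpleGraph (Fin n)} {qc ql r d : ℝ}

/-- The isoperimetric alternative turned into a bound on the conductance. -/
lemma conductance_alternative {κ Λ y : ℝ} (hκ0 : 0 ≤ κ) (hκ1 : 8 * κ ≤ qc) (hκ2 : 4 * κ ≤ ql)
    (hd : 1 ≤ d) (hΛ : 0 < Λ) (hy : 1 / Λ ≤ y) {s b e : ℝ} (hs : 0 ≤ s) (hb : 0 ≤ b)
    (h : s ≤ 8 * Λ * b ∨ s * y / 4 ≤ e) :
    κ / (d * Λ) * s ≤ qc * b ∨ κ / (d * Λ) * s ≤ ql / d * e := by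
  have hd0 : 0 < d := by linarith
  rcases h with h | h
  · left
    calc κ / (d * Λ) * s ≤ κ / (d * Λ) * (8 * Λ * b) := by gcongr
      _ = 8 * κ * b / d := by field_simp
      _ ≤ 8 * κ * b / 1 := by gcongr
      _ ≤ qc * b := by rw [div_one]; gcongr
  · right
    have hqd : 0 ≤ ql / d := div_nonneg (by linarith) hd0.le
    calc κ / (d * Λ) * s = 4 * κ / d * (s * (1 / Λ) / 4) := by field_simp
      _ ≤ ql / d * (s * y / 4) := by gcongr
      _ ≤ ql / d * e := by gcongr

/-- With `lam = φ² / 2`, taking `2 log n / lam` steps brings the factor down to `n ^ (-2)`, which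
beats the `2 n` lost in total variation. Rounding up costs at most one more `log n / lam`, hence `6
/ φ²`. -/
lemma mixingTimeBetween_of_gap {P : Matrix (Fin n) (Fin n) ℝ}
    (hP : P ∈ doublyStochastic ℝ (Fin n)) {κ Λ ε lo : ℝ} (hε : 0 < ε)
    (hκ0 : 0 < κ) (hκ : κ ≤ 1) (hd : 1 ≤ d) (hΛ : 1 ≤ Λ) (hlog : 1 ≤ Real.log n)
    (hn : 2 ≤ ε ^ 2 * n)
    (hc : ∀ x : Fin n → ℝ, ∑ i, x i = 0 →
      ∑ j, (x ᵥ* P) j ^ 2 ≤ (1 - (κ / (d * Λ)) ^ 2 / 2) * ∑ i, x i ^ 2)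
    (hlo : ∃ m : Fin n, ∀ k : ℕ, (k : ℝ) ≤ lo →
      ε < tvDist (Pi.single m (1 : ℝ) ᵥ* P ^ k) (fun _ => (Fintype.card (Fin n) : ℝ)⁻¹)) :
    MixingTimeBetween P ε lo (6 / κ ^ 2 * d ^ 2 * Λ ^ 2 * Real.log n) := by
  obtain ⟨m, hm⟩ := hlo
  have : Nonempty (Fin n) := ⟨m⟩
  have hd0 : 0 < d := by linarith
  have hΛ0 : 0 < Λ := by linarith
  set lam : ℝ := (κ / (d * Λ)) ^ 2 / 2 with hlam
  have hφ : κ / (d * Λ) ≤ 1 := by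
    rw [div_le_one (by positivity)]
    nlinarith
  have hlam0 : 0 < lam := by positivity
  have hφ0 : 0 ≤ κ / (d * Λ) := by positivity
  have hlam1 : lam ≤ 1 := by
    rw [hlam]; nlinarith
  have hn0 : (0 : ℝ) < n := by
    by_contra! h
    nlinarith [sq_nonneg ε]
  refine mixingTimeBetween_of_contraction hP hlam0 hlam1 hε.le hc
    (T := ⌈2 * Real.log n / lam⌉₊) ?_ ?_
    ⟨Pi.single m 1, single_mem_stdSimplex ℝ m, hm⟩
  · rw [Fintype.card_fin]
    have h1 : 2 * Real.log n ≤ ⌈2 * Real.log n / lam⌉₊ * lam := by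
      rw [← div_le_iff₀ hlam0]; exact Nat.le_ceil _
    have h2 : (1 - lam) ^ ⌈2 * Real.log n / lam⌉₊ ≤ 1 / (n : ℝ) ^ 2 := by
      have h3 := Real.add_one_le_exp (-lam)
      calc (1 - lam) ^ ⌈2 * Real.log n / lam⌉₊
          ≤ Real.exp (-lam) ^ ⌈2 * Real.log n / lam⌉₊ := by
            refine pow_le_pow_left₀ (by linarith) (by linarith) _
        _ = Real.exp (-(⌈2 * Real.log n / lam⌉₊ * lam)) := by
            rw [← Real.exp_nat_mul]; congr 1; ring
        _ ≤ Real.exp (-(2 * Real.log n)) := by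
            apply Real.exp_le_exp.2; linarith
        _ = 1 / (n : ℝ) ^ 2 := by
            rw [Real.exp_neg, show 2 * Real.log n = ((2 : ℕ) : ℝ) * Real.log n by norm_num,
              Real.exp_nat_mul, Real.exp_log hn0, one_div]
    calc 2 * (n : ℝ) * (1 - lam) ^ ⌈2 * Real.log n / lam⌉₊ ≤ 2 * n * (1 / (n : ℝ) ^ 2) := by gcongr
      _ = 2 / n := by field_simp
      _ ≤ ε ^ 2 := by rw [div_le_iff₀ hn0]; exact hn
  · have h1 : (⌈2 * Real.log n / lam⌉₊ : ℝ) < 2 * Real.log n / lam + 1 :=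
      Nat.ceil_lt_add_one (by positivity)
    have h2 : 1 ≤ Real.log n / lam := by rw [le_div_iff₀ hlam0]; linarith
    have h3 : 6 / κ ^ 2 * d ^ 2 * Λ ^ 2 * Real.log n = 3 * (Real.log n / lam) := by
      rw [hlam]; field_simp; ring
    rw [h3]
    have h4 : 2 * Real.log n / lam = 2 * (Real.log n / lam) := by ring
    linarith

/-- In a long arc without long range edges the reversible chain moves diffusively. -/
lemma exists_start_diffusive (hqc : 0 ≤ qc) (hql : 0 ≤ ql) (hq : 2 * qc + ql ≤ 1) (hd : 0 < d)
    (hdeg : ∀ v, ((G.neighborSet v).ncard : ℝ) ≤ d) {a L : ℕ} (ha : a + L ≤ n) (hL : 3 ≤ L)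
    (hfree : ∀ i : Fin n, a ≤ i → (i : ℕ) < a + L → G.neighborSet i = ∅) {ε lo : ℝ}
    (hlo : lo * (16 / (L : ℝ) ^ 2) + (L : ℝ) / n < 1 - ε) :
    ∃ m : Fin n, ∀ k : ℕ, (k : ℝ) ≤ lo →
      ε < tvDist (Pi.single m (1 : ℝ) ᵥ* homogeneousChain G qc ql 0 d ^ k)
        (fun _ => (Fintype.card (Fin n) : ℝ)⁻¹) := by
  -- The largest `h` with `2 * h + 1 ≤ L`; for `L ≥ 3` it is positive and `L ≤ 4 * h`. The quadratic
  -- profile grows in mean by `2 * qc / h ^ 2` per step.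
  set h : ℕ := (L - 1) / 2 with hh
  have h1 : 1 ≤ h := by omega
  have h4 : L ≤ 4 * h := by omega
  have hpos : (0 : ℝ) < h := by exact_mod_cast h1
  have hLpos : (0 : ℝ) < L := by exact_mod_cast (by omega : 0 < L)
  obtain ⟨m, hm⟩ := lt_tvDist_of_arc (G := G) (qc := qc) (ql := ql) (r := 0) (d := d)
    (by simpa using hqc) hql hq hd hdeg ha (h := h) (by omega) hfree
    (g := fun u => u ^ 2 / (h : ℝ) ^ 2) (η := 1 / (h : ℝ) ^ 2) (by positivity)
    (fun u => by positivity) (by simp)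
    (fun u hu => by
      rw [one_le_div (by positivity), ← sq_abs u]
      exact pow_le_pow_left₀ hpos.le hu 2)
    (fun u hu => by
      constructor
      · rw [div_le_one (by positivity), ← sq_abs u]
        exact pow_le_pow_left₀ (abs_nonneg _) hu.le 2
      · have e : (qc + 0) * ((u + 1) ^ 2 / (h : ℝ) ^ 2 - u ^ 2 / (h : ℝ) ^ 2) +
            (qc - 0) * ((u - 1) ^ 2 / (h : ℝ) ^ 2 - u ^ 2 / (h : ℝ) ^ 2) =
            2 * qc / (h : ℝ) ^ 2 := by ring
        rw [e]
        gcongr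
        linarith) (ε := ε)
  refine ⟨m, fun k hk => hm k (lt_of_le_of_lt ?_ hlo)⟩
  have h5 : 1 / (h : ℝ) ^ 2 ≤ 16 / (L : ℝ) ^ 2 := by
    rw [div_le_div_iff₀ (by positivity) (by positivity)]
    have : (L : ℝ) ≤ 4 * h := by exact_mod_cast h4
    nlinarith
  have hlo0 : 0 ≤ lo := (Nat.cast_nonneg k).trans hk
  gcongr

/-- In a long arc without long range edges the chain moves at most at unit speed. -/
lemma exists_start_ballistic (hr : |r| ≤ qc) (hql : 0 ≤ ql) (hq : 2 * qc + ql ≤ 1) (hd : 0 < d)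
    (hdeg : ∀ v, ((G.neighborSet v).ncard : ℝ) ≤ d) {a L : ℕ} (ha : a + L ≤ n) (hL : 3 ≤ L)
    (hfree : ∀ i : Fin n, a ≤ i → (i : ℕ) < a + L → G.neighborSet i = ∅) {ε lo : ℝ}
    (hlo : lo * (4 / (L : ℝ)) + (L : ℝ) / n < 1 - ε) :
    ∃ m : Fin n, ∀ k : ℕ, (k : ℝ) ≤ lo →
      ε < tvDist (Pi.single m (1 : ℝ) ᵥ* homogeneousChain G qc ql r d ^ k)
        (fun _ => (Fintype.card (Fin n) : ℝ)⁻¹) := by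
  obtain ⟨hr1, hr2⟩ := abs_le.1 hr
  set h : ℕ := (L - 1) / 2 with hh
  have h1 : 1 ≤ h := by omega
  have h4 : L ≤ 4 * h := by omega
  have hpos : (0 : ℝ) < h := by exact_mod_cast h1
  have hLpos : (0 : ℝ) < L := by exact_mod_cast (by omega : 0 < L)
  obtain ⟨m, hm⟩ := lt_tvDist_of_arc (G := G) (qc := qc) (ql := ql) (r := r) (d := d)
    hr hql hq hd hdeg ha (h := h) (by omega) hfree
    -- With drift a quadratic profile may grow by order `1 / h` near the ends of the arc. The
    -- distance to the centre is `1`-Lipschitz, which is all that is used here.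
    (g := fun u => |u| / (h : ℝ)) (η := 1 / (h : ℝ)) (by positivity)
    (fun u => by positivity) (by simp)
    (fun u hu => by rwa [one_le_div hpos])
    (fun u hu => by
      constructor
      · rw [div_le_one hpos]; exact hu.le
      · have e1 : |u + 1| / (h : ℝ) - |u| / h ≤ 1 / h := by
          rw [← sub_div]
          gcongr
          have := abs_add_le u 1
          rw [abs_one] at this; linarith
        have e2 : |u - 1| / (h : ℝ) - |u| / h ≤ 1 / h := by
          rw [← sub_div]
          gcongr
          have := abs_sub u 1
          rw [abs_one] at this; linarith
        have e3 := mul_le_mul_of_nonneg_left e1 (by linarith : 0 ≤ qc + r)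
        have e4 := mul_le_mul_of_nonneg_left e2 (by linarith : 0 ≤ qc - r)
        have e5 : 2 * qc * (1 / (h : ℝ)) ≤ 1 * (1 / (h : ℝ)) := by gcongr; linarith
        linarith) (ε := ε)
  refine ⟨m, fun k hk => hm k (lt_of_le_of_lt ?_ hlo)⟩
  have h5 : 1 / (h : ℝ) ≤ 4 / (L : ℝ) := by
    rw [div_le_div_iff₀ (by positivity) (by positivity)]
    have : (L : ℝ) ≤ 4 * h := by exact_mod_cast h4
    linarith
  have hlo0 : 0 ≤ lo := (Nat.cast_nonneg k).trans hk
  gcongr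

end MixingTime

/-! ### Assembly of the estimates for large `n` -/

lemma eventually_scale {α ε : ℝ} (hα : 1 < α) (hα2 : α < 2) (hε : 0 < ε) (hε1 : ε < 1) (C : ℝ) :
    ∀ᶠ n : ℕ in atTop, C ≤ (n : ℝ) ^ (α - 1) * Real.log n ∧
      1 ≤ Real.log n ∧ 2 ≤ ε ^ 2 * n ∧ 2 ≤ n ∧
      (n : ℝ) ^ (α - 1) * Real.log n / n < (1 - ε) / 2 ∧
      1 / ((n : ℝ) ^ (α - 1) * Real.log n) ≤ (n : ℝ) ^ (1 - α) ∧
      ((n : ℝ) ^ (α - 1) * Real.log n) ^ 2 = (n : ℝ) ^ (2 * α - 2) * Real.log n ^ 2 := by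
  have h1 := (tendsto_rpow_mul_log (β := α - 1) (by linarith)).eventually_ge_atTop C
  have h2 := (Real.tendsto_log_atTop.comp tendsto_natCast_atTop_atTop).eventually_ge_atTop 1
  have h3 := ((tendsto_natCast_atTop_atTop (R := ℝ)).const_mul_atTop
    (by positivity : 0 < ε ^ 2)).eventually_ge_atTop 2
  have h4 := (tendsto_log_div_rpow (β := 2 - α) (by linarith)).eventually_lt_const
    (by linarith : 0 < (1 - ε) / 2)
  filter_upwards [h1, h2, h3, h4, eventually_ge_atTop 2] with n h1 h2 h3 h4 h5
  have hn : (0 : ℝ) < n := by positivity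
  simp only [Function.comp_apply] at h2
  refine ⟨h1, h2, h3, h5, ?_, ?_, ?_⟩
  · refine lt_of_eq_of_lt ?_ h4
    have : (n : ℝ) = (n : ℝ) ^ (α - 1) * (n : ℝ) ^ (2 - α) := by
      rw [← Real.rpow_add hn, show α - 1 + (2 - α) = 1 by ring, Real.rpow_one]
    have hp : 0 < (n : ℝ) ^ (α - 1) := by positivity
    have hp2 : 0 < (n : ℝ) ^ (2 - α) := by positivity
    rw [div_eq_div_iff hn.ne' hp2.ne']
    calc (n : ℝ) ^ (α - 1) * Real.log n * (n : ℝ) ^ (2 - α) =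
        Real.log n * ((n : ℝ) ^ (α - 1) * (n : ℝ) ^ (2 - α)) := by ring
      _ = Real.log n * n := by rw [← this]
  · rw [show 1 - α = -(α - 1) by ring, Real.rpow_neg hn.le, one_div]
    have hp : 0 < (n : ℝ) ^ (α - 1) := by positivity
    gcongr
    nlinarith
  · rw [mul_pow, ← Real.rpow_natCast ((n : ℝ) ^ (α - 1)) 2, ← Real.rpow_mul hn.le]
    congr 2
    push_cast; ring

lemma upper_scale_eq {κ d Λ y l : ℝ} (h : Λ ^ 2 = y * l ^ 2) :
    6 / κ ^ 2 * d ^ 2 * Λ ^ 2 * l = 6 / κ ^ 2 * d ^ 2 * y * l ^ 3 := by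
  rw [h]; ring

theorem exists_aas_mixingTimeBetween_reversible {ε qc ql κ : ℝ} (hε0 : 0 < ε) (hε1 : ε < 1) (hqc : 0 < qc) (hql : 0 < ql)
    (hq : 2 * qc + ql ≤ 1) (hκ0 : 0 < κ) (hκ1 : 8 * κ ≤ qc) (hκ2 : 4 * κ ≤ ql)
    {α : ℝ} (hα : 1 < α) (hα2 : α < 2) :
    ∃ c₁ : ℝ, 0 < c₁ ∧ ∀ d : ℝ, IsDegreeBound α d → AAS α fun n G =>
      homogeneousChain G qc ql 0 d ∈ Matrix.rowStochastic ℝ (Fin n) ∧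
      MixingTimeBetween (homogeneousChain G qc ql 0 d) ε
        (c₁ * (n : ℝ) ^ (2 * α - 2) * Real.log n ^ 2)
        (6 / κ ^ 2 * d ^ 2 * (n : ℝ) ^ (2 * α - 2) * Real.log n ^ 3) := by
  have hκ3 : κ ≤ 1 := by linarith
  obtain ⟨c, hc0, harc⟩ := exists_aas_free_arc hα hα2
  obtain ⟨w, hwin⟩ := exists_aas_window hα
  -- As `c * Λ ≤ L`, this constant makes the diffusive growth up to time `lo` at most `(1 - ε) / 2`;
  -- the proportion `L / n` of the arc is eventually below the other half.
  refine ⟨c ^ 2 * (1 - ε) / 32, div_pos (mul_pos (by positivity) (by linarith)) (by norm_num),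
    fun d hd => ?_⟩
  have hd1 := one_le_of_isDegreeBound hα hα2 hd
  have hd0 : 0 < d := by linarith
  refine (((AAS.and hd (aas_isoperimetry hα)).and (harc.and hwin))).mono ?_
  filter_upwards [eventually_scale hα hα2 hε0 hε1 (max (max 1 (3 / c)) w)]
    with n ⟨hC, hlog, hεn, hn2, hΛn, hΛinv, hΛsq⟩ G
    ⟨⟨hdeg, hiso⟩, ⟨a, L, haL, hcL, hLΛ, hfree⟩, hw⟩
  set Λ : ℝ := (n : ℝ) ^ (α - 1) * Real.log n with hΛdef
  have hΛ1 : 1 ≤ Λ := (le_max_left _ _).trans ((le_max_left _ _).trans hC)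
  have hΛc : 3 / c ≤ Λ := (le_max_right _ _).trans ((le_max_left _ _).trans hC)
  have hΛw : (w : ℝ) ≤ Λ := (le_max_right _ _).trans hC
  have hΛ0 : 0 < Λ := by linarith
  have hr0 : |(0 : ℝ)| ≤ qc := by simpa using hqc.le
  have hP := homogeneousChain_mem_doublyStochastic hr0 hql.le hq hd0 hdeg
  refine ⟨(mem_doublyStochastic_iff_mem_rowStochastic_and_mem_colStochastic.1 hP).1, ?_⟩
  have hL3 : 3 ≤ L := by
    have h1 : 3 ≤ c * Λ := by rw [div_le_iff₀ hc0] at hΛc; linarith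
    have : (3 : ℝ) ≤ L := h1.trans hcL
    exact_mod_cast this
  have hn0 : (0 : ℝ) < n := by positivity
  set φ : ℝ := κ / (d * Λ) with hφ
  have hφ0 : 0 ≤ φ := by positivity
  have hφΛ : φ * Λ ≤ κ := by
    have : φ * Λ = κ / d := by rw [hφ]; field_simp
    rw [this]; exact div_le_self hκ0.le hd1
  have hφ1 : φ ≤ 1 := by
    have := mul_le_mul_of_nonneg_left hΛ1 hφ0
    linarith
  rw [← upper_scale_eq hΛsq, mul_assoc (c ^ 2 * (1 - ε) / 32), ← hΛsq]
  refine mixingTimeBetween_of_gap hP hε0 hκ0 hκ3 hd1 hΛ1 hlog hεn ?_ ?_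
  · have hup := fun (x : Fin n → ℝ) (hx : ∑ i, x i = 0) =>
      sum_vecMul_mul_le hqc.le hr0 hql.le hq hd0 hdeg hφ0
        (fun S hS => conductance_alternative hκ0.le hκ1 hκ2 hd1 hΛ0 hΛinv
          (Nat.cast_nonneg _) (Nat.cast_nonneg _) (hiso S hS)) x hx
    -- The window length is fixed while `Λ` grows, so `φ * w ≤ κ`. Hence `δ = φ ^ 2` is admissible
    -- at the bottom of the spectrum, and both ends have the same gap.
    have hφw : φ ^ 2 * (w : ℝ) ^ 2 ≤ κ := by
      have h1 : φ * w ≤ κ := (mul_le_mul_of_nonneg_left hΛw hφ0).trans hφΛ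
      have h2 : 0 ≤ φ * w := by positivity
      nlinarith
    have hlow := fun (x : Fin n → ℝ) (_ : ∑ i, x i = 0) =>
      neg_le_sum_vecMul_mul hn2 hqc.le hql.le hq hd0 hdeg hw (sq_nonneg φ)
        (by linarith) (by linarith) x
    intro x hx
    have hc1 : 0 < 1 - φ ^ 2 / 2 := by nlinarith
    refine (sum_sq_vecMul_le_of_symm hP homogeneousChain_symm hc1 hup hlow x hx).trans ?_
    have : 0 ≤ ∑ i, x i ^ 2 := Finset.sum_nonneg fun _ _ => sq_nonneg _
    gcongr
    nlinarith [sq_nonneg φ]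
  · refine exists_start_diffusive hqc.le hql.le hq hd0 hdeg haL hL3 hfree ?_
    have h1 : (L : ℝ) / n ≤ Λ / n := by gcongr
    have h2 : c ^ 2 * (1 - ε) / 32 * Λ ^ 2 * (16 / (L : ℝ) ^ 2) ≤ (1 - ε) / 2 := by
      have hLpos : (0 : ℝ) < L := by positivity
      have h3 : (c * Λ) ^ 2 ≤ (L : ℝ) ^ 2 := pow_le_pow_left₀ (by positivity) hcL 2
      rw [mul_div_assoc', div_le_iff₀ (by positivity)]
      have h4 := mul_le_mul_of_nonneg_left h3 (by linarith : 0 ≤ (1 - ε) / 2)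
      calc c ^ 2 * (1 - ε) / 32 * Λ ^ 2 * 16 = (1 - ε) / 2 * (c * Λ) ^ 2 := by ring
        _ ≤ _ := h4
    linarith

theorem exists_aas_mixingTimeBetween_lazy {ε qc ql κ : ℝ} (hε0 : 0 < ε) (hε1 : ε < 1) (hqc : 0 < qc) (hql : 0 < ql)
    (hq : 2 * qc + ql ≤ 1) (hκ0 : 0 < κ) (hκ1 : 8 * κ ≤ qc) (hκ2 : 4 * κ ≤ ql)
    {α : ℝ} (hα : 1 < α) (hα2 : α < 2)
    {r : ℝ} (hr : |r| ≤ qc) :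
    ∃ c₁ : ℝ, 0 < c₁ ∧ ∀ d : ℝ, IsDegreeBound α d → AAS α fun n G =>
      homogeneousChain G qc ql r d ∈ Matrix.rowStochastic ℝ (Fin n) ∧
      (2 * qc + ql ≤ 1 / 2 → IsLazy (homogeneousChain G qc ql r d)) ∧
      (IsLazy (homogeneousChain G qc ql r d) →
        MixingTimeBetween (homogeneousChain G qc ql r d) ε
          (c₁ * (n : ℝ) ^ (α - 1) * Real.log n)
          (6 / κ ^ 2 * d ^ 2 * (n : ℝ) ^ (2 * α - 2) * Real.log n ^ 3)) := by
  have hκ3 : κ ≤ 1 := by linarith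
  obtain ⟨c, hc0, harc⟩ := exists_aas_free_arc hα hα2
  -- Chosen as in the reversible case, now against the ballistic rate `4 / L`.
  refine ⟨c * (1 - ε) / 8, div_pos (mul_pos hc0 (by linarith)) (by norm_num),
    fun d hd => ?_⟩
  have hd1 := one_le_of_isDegreeBound hα hα2 hd
  have hd0 : 0 < d := by linarith
  refine (((AAS.and hd (aas_isoperimetry hα)).and harc)).mono ?_
  filter_upwards [eventually_scale hα hα2 hε0 hε1 (max 1 (3 / c))]
    with n ⟨hC, hlog, hεn, hn2, hΛn, hΛinv, hΛsq⟩ G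
    ⟨⟨hdeg, hiso⟩, ⟨a, L, haL, hcL, hLΛ, hfree⟩⟩
  set Λ : ℝ := (n : ℝ) ^ (α - 1) * Real.log n with hΛdef
  have hΛ1 : 1 ≤ Λ := (le_max_left _ _).trans hC
  have hΛc : 3 / c ≤ Λ := (le_max_right _ _).trans hC
  have hΛ0 : 0 < Λ := by linarith
  have hP := homogeneousChain_mem_doublyStochastic hr hql.le hq hd0 hdeg
  refine ⟨(mem_doublyStochastic_iff_mem_rowStochastic_and_mem_colStochastic.1 hP).1,
    fun hq2 => homogeneousChain_isLazy hr hql.le hq2 hd0 hdeg, fun hlazy => ?_⟩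
  have hL3 : 3 ≤ L := by
    have h1 : 3 ≤ c * Λ := by rw [div_le_iff₀ hc0] at hΛc; linarith
    have : (3 : ℝ) ≤ L := h1.trans hcL
    exact_mod_cast this
  have hn0 : (0 : ℝ) < n := by positivity
  rw [← upper_scale_eq hΛsq, mul_assoc (c * (1 - ε) / 8), ← hΛdef]
  refine mixingTimeBetween_of_gap hP hε0 hκ0 hκ3 hd1 hΛ1 hlog hεn ?_ ?_
  · intro x hx
    exact (sum_sq_vecMul_le_of_isLazy hP hlazy x).trans
      (sum_vecMul_mul_le hqc.le hr hql.le hq hd0 hdeg (by positivity)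
        (fun S hS => conductance_alternative hκ0.le hκ1 hκ2 hd1 hΛ0 hΛinv
          (Nat.cast_nonneg _) (Nat.cast_nonneg _) (hiso S hS)) x hx)
  · refine exists_start_ballistic hr hql.le hq hd0 hdeg haL hL3 hfree ?_
    have h1 : (L : ℝ) / n ≤ Λ / n := by gcongr
    have h2 : c * (1 - ε) / 8 * Λ * (4 / (L : ℝ)) ≤ (1 - ε) / 2 := by
      have hLpos : (0 : ℝ) < L := by positivity
      rw [mul_div_assoc', div_le_iff₀ hLpos]
      have h4 := mul_le_mul_of_nonneg_left hcL (by linarith : 0 ≤ (1 - ε) / 2)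
      calc c * (1 - ε) / 8 * Λ * 4 = (1 - ε) / 2 * (c * Λ) := by ring
        _ ≤ _ := h4
    linarith

end CycleMixing

end

theorem mainTheorem1 (ε : ℝ) (hε0 : 0 < ε) (hε1 : ε < 1)
    (qc ql : ℝ) (hqc : 0 < qc) (hql : 0 < ql) (hq : 2 * qc + ql ≤ 1) :
    -- for every `α` there is an a.a.s. bound `d` on the long range degrees
    (∀ α : ℝ, 1 < α → α < 2 → ∃ d : ℝ, CycleMixing.IsDegreeBound α d) ∧
    -- the reversible homogeneous chain
    (∃ c₂ : ℝ, 0 < c₂ ∧ ∀ α : ℝ, 1 < α → α < 2 → ∃ c₁ : ℝ, 0 < c₁ ∧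
      ∀ d : ℝ, CycleMixing.IsDegreeBound α d →
        CycleMixing.AAS α fun n G =>
          CycleMixing.homogeneousChain G qc ql 0 d ∈ Matrix.rowStochastic ℝ (Fin n) ∧
          CycleMixing.MixingTimeBetween (CycleMixing.homogeneousChain G qc ql 0 d) ε
            (c₁ * (n : ℝ) ^ (2 * α - 2) * Real.log n ^ 2)
            (c₂ * d ^ 2 * (n : ℝ) ^ (2 * α - 2) * Real.log n ^ 3)) ∧
    -- lazy homogeneous chains with an arbitrary drift `r`
    (∀ r : ℝ, |r| ≤ qc →
      ∃ c₂ : ℝ, 0 < c₂ ∧ ∀ α : ℝ, 1 < α → α < 2 → ∃ c₁ : ℝ, 0 < c₁ ∧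
        ∀ d : ℝ, CycleMixing.IsDegreeBound α d →
          CycleMixing.AAS α fun n G =>
            CycleMixing.homogeneousChain G qc ql r d ∈ Matrix.rowStochastic ℝ (Fin n) ∧
            (2 * qc + ql ≤ 1 / 2 →
              CycleMixing.IsLazy (CycleMixing.homogeneousChain G qc ql r d)) ∧
            (CycleMixing.IsLazy (CycleMixing.homogeneousChain G qc ql r d) →
              CycleMixing.MixingTimeBetween (CycleMixing.homogeneousChain G qc ql r d) ε
                (c₁ * (n : ℝ) ^ (α - 1) * Real.log n)
                (c₂ * d ^ 2 * (n : ℝ) ^ (2 * α - 2) * Real.log n ^ 3))) := by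
  -- The numbers `8` and `4` are those of the isoperimetric alternative. Since `κ` involves neither
  -- `α` nor `d`, neither does the upper constant `6 / κ ^ 2`.
  set κ : ℝ := min (qc / 8) (ql / 4) with hκ
  have hκ0 : 0 < κ := lt_min (by linarith) (by linarith)
  have hκ1 : 8 * κ ≤ qc := by
    have : κ ≤ qc / 8 := min_le_left _ _
    linarith
  have hκ2 : 4 * κ ≤ ql := by
    have : κ ≤ ql / 4 := min_le_right _ _
    linarith
  exact ⟨fun α hα _ => CycleMixing.exists_isDegreeBound hα,
    ⟨6 / κ ^ 2, by positivity, fun α hα hα2 =>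
      CycleMixing.exists_aas_mixingTimeBetween_reversible hε0 hε1 hqc hql hq hκ0 hκ1 hκ2 hα hα2⟩,
    fun r hr => ⟨6 / κ ^ 2, by positivity, fun α hα hα2 =>
      CycleMixing.exists_aas_mixingTimeBetween_lazy hε0 hε1 hqc hql hq hκ0 hκ1 hκ2 hα hα2 hr⟩⟩
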